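/- Let $k$ be a commutative ring. All functors below are covariant functors on the category of commutative $k$-algebras. A functor of $k$-modules (resp. of commutative $k$-algebras) is a functor $F$ such that each $F(B)$ is a $B$-module (resp. a commutative $B$-algebra), functorially in $B$. For a $k$-module $E$ let ${\bf E}$ be the functor of $k$-modules ${\bf E}(B)=E\otimes_k B$; if $E$ is a commutative $k$-algebra, ${\bf E}$ is a functor of commutative $k$-algebras; ${\bf k}(B)=B$. Write $F_{|B}$ for the restriction of $F$ to commutative $B$-algebras. The dual of a functor of $k$-modules $F$ is the functor of $k$-modules $F^*={\bf Hom}_k(F,{\bf k})$, $F^*(B)={\rm Hom}_B(F_{|B},{\bf k}_{|B})$. The spectrum of a functor of commutative $k$-algebras $\mathcal A$ is the functor of sets $({\rm Spec}\,\mathcal A)(B)={\rm Hom}_{k\text{-alg}}(\mathcal A,{\bf B})$. The dual of a functor of abelian monoids $G$ is the functor of abelian monoids $G^*={\bf Hom}_{monoids}(G,{\bf k})$, $G^*(B)={\rm Hom}_{monoids}(G_{|B},{\bf k}_{|B})$, where ${\bf k}$ is regarded as a functor of monoids by multiplication and $G^*(B)$ carries the pointwise product. Let $\mathcal C_1$ be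 the category of abelian affine $k$-monoids $G={\rm Spec}\,A$ with $A$ a commutative $k$-algebra that is projective as a $k$-module, i.e. of functors of abelian monoids whose underlying functor of sets is isomorphic to $B\mapsto{\rm Hom}_{k\text{-alg}}(A,B)$ for such an $A$. Let $\mathcal C_2$ be the category of functors of abelian monoids whose underlying functor of sets is isomorphic to ${\rm Spec}\,{\bf E}^*$ for some projective $k$-module $E$ and some structure of functor of commutative $k$-algebras on the functor of $k$-modules ${\bf E}^*$. Morphisms in both categories are the morphisms of functors of monoids. Theorem. (1) $G\mapsto G^*$ maps $\mathcal C_1$ to $\mathcal C_2$ and $\mathcal C_2$ to $\mathcal C_1$, and these two contravariant functors are mutually inverse anti-equivalences of categories. For every $G$ in $\mathcal C_1$ or $\mathcal C_2$ the canonical morphism $G\to G^{**}$, $g\mapsto(\chi\mapsto\chi(g))$, is an isomorphism. (2) More precisely, if $G={\rm Spec}\,A$ is in $\mathcal C_1$, then the underlying functor of sets of $G^*$ is isomorphic to ${\rm Spec}\,{\bf A}^*$ for some structure of functor of commutative $k$-algebras on ${\bf A}^*$; and if $H={\rm Spec}\,{\bf E}^*$ is in $\mathcal C_2$ with $E$ projective,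 then $H^*$ is isomorphic, as a functor of sets, to ${\rm Spec}\,A$ for a commutative $k$-algebra $A$ that is isomorphic to $E$ as a $k$-module. (3) (Cartier duality.) Let $\mathcal C_f$ be the category of finite commutative $k$-group schemes, i.e. of functors of abelian groups whose underlying functor of sets is the functor of points of ${\rm Spec}\,A$, where $A$ is a commutative $k$-algebra that is a finitely generated projective $k$-module. Then $G\mapsto G^*$ is an anti-equivalence of $\mathcal C_f$ with itself, inverse to itself through the canonical isomorphisms $G\to G^{**}$; and for $G$ in $\mathcal C_f$ all characters take invertible values, so that $G^*={\bf Hom}_{groups}(G,{\mathbb G}_m)$. -/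

import Mathlib

open CategoryTheory Opposite
open scoped TensorProduct

universe w u

noncomputable section

namespace CartierDuality

/-! ### Functors of modules and functors of algebras

All functors are defined on the category of commutative `k`-algebras. The functor `𝐤` is
`B ↦ k ⊗ B = B`. -/

/-- A functor of `k`-modules: a covariant functor `F` on commutative `k`-algebras such that `F(B)`
is a `B`-module, functorially in `B`. -/
structure ModuleFunctor (k : Type u) [CommRing k] where
  obj : CommAlgCat.{u} k → Type w
  [addCommGroup : ∀ B, AddCommGroup (obj B)]
  [module : ∀ B : CommAlgCat.{u} k, Module B (obj B)]
  map : ∀ {B C : CommAlgCat.{u} k}, (B ⟶ C) → (obj B →+ obj C)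
  map_smul : ∀ {B C : CommAlgCat.{u} k} (f : B ⟶ C) (b : B) (x : obj B),
    map f (b • x) = f.hom b • map f x
  map_id : ∀ (B : CommAlgCat.{u} k) (x : obj B), map (𝟙 B) x = x
  map_comp : ∀ {B C D : CommAlgCat.{u} k} (f : B ⟶ C) (g : C ⟶ D) (x : obj B),
    map (f ≫ g) x = map g (map f x)

attribute [instance] ModuleFunctor.addCommGroup ModuleFunctor.module

/-- A functor of commutative `k`-algebras: a covariant functor `𝒜` on commutative `k`-algebras such
that `𝒜(B)` is a commutative `B`-algebra, functorially in `B`. -/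
structure AlgebraFunctor (k : Type u) [CommRing k] where
  obj : CommAlgCat.{u} k → Type w
  [commRing : ∀ B, CommRing (obj B)]
  [algebra : ∀ B : CommAlgCat.{u} k, Algebra B (obj B)]
  map : ∀ {B C : CommAlgCat.{u} k}, (B ⟶ C) → (obj B →+* obj C)
  map_algebraMap : ∀ {B C : CommAlgCat.{u} k} (f : B ⟶ C) (b : B),
    map f (algebraMap B (obj B) b) = algebraMap C (obj C) (f.hom b)
  map_id : ∀ (B : CommAlgCat.{u} k) (x : obj B), map (𝟙 B) x = x
  map_comp : ∀ {B C D : CommAlgCat.{u} k} (f : B ⟶ C) (g : C ⟶ D) (x : obj B),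
    map (f ≫ g) x = map g (map f x)

attribute [instance] AlgebraFunctor.commRing AlgebraFunctor.algebra

variable {k : Type u} [CommRing k]

/-- The functor of `k`-modules underlying a functor of commutative `k`-algebras. -/
def AlgebraFunctor.toModuleFunctor (𝒜 : AlgebraFunctor.{w} k) : ModuleFunctor.{w} k where
  obj := 𝒜.obj
  map f := (𝒜.map f).toAddMonoidHom
  map_smul f b x := by simp [Algebra.smul_def, 𝒜.map_algebraMap]
  map_id := 𝒜.map_id
  map_comp := 𝒜.map_comp

/-- Isomorphisms of functors of `k`-modules. -/
structure ModuleFunctor.Iso (F : ModuleFunctor.{w} k) (H : ModuleFunctor.{w} k) where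
  app : ∀ B : CommAlgCat.{u} k, F.obj B ≃ₗ[B] H.obj B
  naturality : ∀ {B C : CommAlgCat.{u} k} (f : B ⟶ C) (x : F.obj B),
    app C (F.map f x) = H.map f (app B x)

/-- The quasi-coherent functor `𝐄` of a `k`-module `E`: `𝐄(B) = B ⊗ E`. -/
def quasiCoherent (E : Type u) [AddCommGroup E] [Module k E] : ModuleFunctor.{u} k where
  obj B := B ⊗[k] E
  map f := (TensorProduct.map f.hom.toLinearMap LinearMap.id).toAddMonoidHom
  map_smul f b x := by
    induction x with
    | zero => simp
    | tmul c e => simp [TensorProduct.smul_tmul']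
    | add x y hx hy => rw [smul_add, map_add, hx, hy, map_add, smul_add]
  map_id B x := by
    induction x with
    | zero => simp
    | tmul c e => simp
    | add x y hx hy => rw [map_add, hx, hy]
  map_comp f g x := by
    induction x with
    | zero => simp
    | tmul c e => simp
    | add x y hx hy => rw [map_add, hx, hy, map_add, map_add]

/-! ### The dual of a functor of modules -/

/-- `F*(B) = Hom_B(F|_B, 𝐁)`: the morphisms of functors of modules, from the restriction of `F` to
commutative `B`-algebras to the functor `C ↦ C`. A commutative `B`-algebra is a commutative
`k`-algebra `C` together with a morphism `B ⟶ C`. -/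
structure ModuleFunctor.DualObj (F : ModuleFunctor.{w} k) (B : CommAlgCat.{u} k) where
  app : ∀ {C : CommAlgCat.{u} k}, (B ⟶ C) → (F.obj C →ₗ[C] C)
  naturality : ∀ {C D : CommAlgCat.{u} k} (f : B ⟶ C) (g : C ⟶ D) (x : F.obj C),
    app (f ≫ g) (F.map g x) = g.hom (app f x)

namespace ModuleFunctor.DualObj

variable {F : ModuleFunctor.{w} k} {B : CommAlgCat.{u} k}

instance : Zero (F.DualObj B) := ⟨⟨fun _ => 0, by simp⟩⟩

instance : Add (F.DualObj B) :=
  ⟨fun φ ψ => ⟨fun f => φ.app f + ψ.app f, by simp [φ.naturality, ψ.naturality]⟩⟩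

instance : Neg (F.DualObj B) := ⟨fun φ => ⟨fun f => - φ.app f, by simp [φ.naturality]⟩⟩

instance : SMul B (F.DualObj B) :=
  ⟨fun b φ => ⟨fun f => f.hom b • φ.app f, by simp [φ.naturality]⟩⟩

@[simp] lemma zero_app {C : CommAlgCat.{u} k} (f : B ⟶ C) : (0 : F.DualObj B).app f = 0 := rfl

@[simp] lemma add_app {C : CommAlgCat.{u} k} (φ ψ : F.DualObj B) (f : B ⟶ C) :
    (φ + ψ).app f = φ.app f + ψ.app f := rfl

@[simp] lemma neg_app {C : CommAlgCat.{u} k} (φ : F.DualObj B) (f : B ⟶ C) :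
    (-φ).app f = - φ.app f := rfl

@[simp] lemma smul_app {C : CommAlgCat.{u} k} (b : B) (φ : F.DualObj B) (f : B ⟶ C) :
    (b • φ).app f = f.hom b • φ.app f := rfl

lemma ext_app {φ ψ : F.DualObj B}
    (h : ∀ {C : CommAlgCat.{u} k} (f : B ⟶ C), φ.app f = ψ.app f) : φ = ψ := by
  obtain ⟨a, _⟩ := φ
  obtain ⟨b, _⟩ := ψ
  obtain rfl : @a = @b := by
    funext C f
    exact h f
  rfl

instance : AddCommGroup (F.DualObj B) where
  add_assoc _ _ _ := ext_app fun _ => add_assoc _ _ _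
  zero_add _ := ext_app fun _ => zero_add _
  add_zero _ := ext_app fun _ => add_zero _
  add_comm _ _ := ext_app fun _ => add_comm _ _
  neg_add_cancel _ := ext_app fun _ => neg_add_cancel _
  nsmul := nsmulRec
  zsmul := zsmulRec

instance : Module B (F.DualObj B) where
  one_smul _ := ext_app fun _ => by simp
  mul_smul _ _ _ := ext_app fun _ => by simp [mul_smul]
  smul_zero _ := ext_app fun _ => by simp
  smul_add _ _ _ := ext_app fun _ => by simp
  add_smul _ _ _ := ext_app fun _ => by simp [add_smul]
  zero_smul _ := ext_app fun _ => by simp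

end ModuleFunctor.DualObj

/-- The dual `F* = 𝐇𝐨𝐦_k(F, 𝐤)` of a functor of `k`-modules. -/
def ModuleFunctor.dual (F : ModuleFunctor.{w} k) : ModuleFunctor.{max (u + 1) w} k where
  obj B := F.DualObj B
  map h :=
    { toFun φ := ⟨fun f => φ.app (h ≫ f), fun f g x => by
        rw [← φ.naturality, Category.assoc]⟩
      map_zero' := rfl
      map_add' _ _ := rfl }
  map_smul h b φ := DualObj.ext_app fun f => by simp
  map_id B φ := DualObj.ext_app fun f => by simp
  map_comp h h' φ := DualObj.ext_app fun f => by simp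

/-! ### Spectra -/

/-- Morphisms of functors of commutative `k`-algebras from `𝒜` to the quasi-coherent functor of
algebras `𝐁`, where `𝐁(C) = C ⊗ B`. -/
structure AlgebraFunctor.SpecObj (𝒜 : AlgebraFunctor.{w} k) (B : CommAlgCat.{u} k) where
  app : ∀ C : CommAlgCat.{u} k, 𝒜.obj C →ₐ[C] C ⊗[k] B
  naturality : ∀ {C D : CommAlgCat.{u} k} (f : C ⟶ D) (x : 𝒜.obj C),
    app D (𝒜.map f x) = Algebra.TensorProduct.map f.hom (AlgHom.id k B) (app C x)

lemma AlgebraFunctor.SpecObj.ext_app {𝒜 : AlgebraFunctor.{w} k} {B : CommAlgCat.{u} k}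
    {φ ψ : 𝒜.SpecObj B} (h : ∀ C x, φ.app C x = ψ.app C x) : φ = ψ := by
  obtain ⟨a, _⟩ := φ
  obtain ⟨b, _⟩ := ψ
  obtain rfl : a = b := funext fun C => AlgHom.ext (h C)
  rfl

/-- The spectrum of a functor of commutative `k`-algebras: `(Spec 𝒜)(B) = Hom_{k-alg}(𝒜, 𝐁)`. -/
def spec (𝒜 : AlgebraFunctor.{u + 1} k) : CommAlgCat.{u} k ⥤ Type (u + 1) where
  obj B := 𝒜.SpecObj B
  map {B B'} h := TypeCat.ofHom fun φ =>
    { app C := (Algebra.TensorProduct.map (AlgHom.id C C) h.hom).comp (φ.app C)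
      naturality f x := by
        simp only [AlgHom.comp_apply, φ.naturality]
        generalize φ.app _ x = y
        induction y with
        | zero => simp
        | tmul c e => simp
        | add x y hx hy => rw [map_add, map_add, hx, hy, map_add, map_add] }
  map_id B := by
    ext φ
    exact AlgebraFunctor.SpecObj.ext_app fun C x => by simp
  map_comp h h' := by
    ext φ
    refine AlgebraFunctor.SpecObj.ext_app fun C x => ?_
    change Algebra.TensorProduct.map (AlgHom.id C C) (h ≫ h').hom (φ.app C x) =
      Algebra.TensorProduct.map (AlgHom.id C C) h'.hom
        (Algebra.TensorProduct.map (AlgHom.id C C) h.hom (φ.app C x))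
    generalize φ.app _ x = y
    induction y with
    | zero => simp
    | tmul c e => simp
    | add x y hx hy => rw [map_add, hx, hy, map_add, map_add]

/-- The functor of points `B ↦ Hom_{k-alg}(A, B)` of the affine `k`-scheme `Spec A`. -/
abbrev points (A : CommAlgCat.{u} k) : CommAlgCat.{u} k ⥤ Type (u + 1) :=
  coyoneda.obj (op A) ⋙ uliftFunctor.{u + 1}

/-! ### Functors of abelian monoids and their duals -/

/-- Functors of abelian monoids on commutative `k`-algebras, with their morphisms. -/
abbrev MonoidFunctor (k : Type u) [CommRing k] := CommAlgCat.{u} k ⥤ CommMonCat.{u + 1}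

/-- `G*(B) = Hom_{monoids}(G|_B, 𝐁)`: the morphisms of functors of monoids, from the restriction of
`G` to commutative `B`-algebras to the functor `C ↦ (C, ·)`. -/
structure Character (G : MonoidFunctor k) (B : CommAlgCat.{u} k) where
  app : ∀ {C : CommAlgCat.{u} k}, (B ⟶ C) → (G.obj C →* C)
  naturality : ∀ {C D : CommAlgCat.{u} k} (f : B ⟶ C) (g : C ⟶ D) (x : G.obj C),
    app (f ≫ g) ((G.map g).hom x) = g.hom (app f x)

namespace Character

variable {G : MonoidFunctor k} {B : CommAlgCat.{u} k}

lemma ext_app {χ ψ : Character G B}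
    (h : ∀ {C : CommAlgCat.{u} k} (f : B ⟶ C), χ.app f = ψ.app f) : χ = ψ := by
  obtain ⟨a, _⟩ := χ
  obtain ⟨b, _⟩ := ψ
  obtain rfl : @a = @b := by
    funext C f
    exact h f
  rfl

instance : One (Character G B) := ⟨⟨fun _ => 1, by simp⟩⟩

instance : Mul (Character G B) :=
  ⟨fun χ ψ => ⟨fun f => χ.app f * ψ.app f, by simp [χ.naturality, ψ.naturality]⟩⟩

@[simp] lemma one_app {C : CommAlgCat.{u} k} (f : B ⟶ C) : (1 : Character G B).app f = 1 := rfl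

@[simp] lemma mul_app {C : CommAlgCat.{u} k} (χ ψ : Character G B) (f : B ⟶ C) :
    (χ * ψ).app f = χ.app f * ψ.app f := rfl

instance : CommMonoid (Character G B) where
  mul_assoc _ _ _ := ext_app fun _ => mul_assoc _ _ _
  one_mul _ := ext_app fun _ => one_mul _
  mul_one _ := ext_app fun _ => mul_one _
  mul_comm _ _ := ext_app fun _ => mul_comm _ _

/-- Restriction of a character along a morphism of algebras. -/
def res {B' : CommAlgCat.{u} k} (h : B ⟶ B') : Character G B →* Character G B' where
  toFun χ := ⟨fun f => χ.app (h ≫ f), fun f g x => by rw [← χ.naturality, Category.assoc]⟩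
  map_one' := rfl
  map_mul' _ _ := rfl

@[simp] lemma res_app {B' C : CommAlgCat.{u} k} (h : B ⟶ B') (χ : Character G B) (f : B' ⟶ C) :
    (res h χ).app f = χ.app (h ≫ f) := rfl

/-- Composition of a character of `G'` with a morphism `G ⟶ G'`. -/
def comap {G' : MonoidFunctor k} (τ : G ⟶ G') : Character G' B →* Character G B where
  toFun χ := ⟨fun {C} f => (χ.app f).comp (τ.app C).hom, fun {C D} f g x => by
    have := congrArg (fun t => t.hom x) (τ.naturality g)
    simp only [CommMonCat.hom_comp, MonoidHom.comp_apply] at this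
    rw [MonoidHom.comp_apply, MonoidHom.comp_apply, this, χ.naturality]⟩
  map_one' := rfl
  map_mul' _ _ := rfl

@[simp] lemma comap_app {G' : MonoidFunctor k} (τ : G ⟶ G') (χ : Character G' B)
    {C : CommAlgCat.{u} k} (f : B ⟶ C) :
    (comap τ χ).app f = (χ.app f).comp (τ.app C).hom := rfl

end Character

/-- The dual functor of monoids `G* = 𝐇𝐨𝐦_{monoids}(G, 𝐤)`, with pointwise multiplication. -/
def dual (G : MonoidFunctor k) : MonoidFunctor k where
  obj B := CommMonCat.of (Character G B)
  map h := CommMonCat.ofHom (Character.res h)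
  map_id B := by
    ext χ
    refine Character.ext_app fun f => ?_
    change Character.app χ (𝟙 B ≫ f) = Character.app χ f
    rw [Category.id_comp]
  map_comp h h' := by
    ext χ
    refine Character.ext_app fun f => ?_
    change Character.app χ ((h ≫ h') ≫ f) = Character.app χ (h ≫ h' ≫ f)
    rw [Category.assoc]

/-- The contravariant functor `G ↦ G*` on functors of abelian monoids. -/
def dualFunctor (k : Type u) [CommRing k] : (MonoidFunctor k)ᵒᵖ ⥤ MonoidFunctor k where
  obj G := dual G.unop
  map τ := { app := fun _ => CommMonCat.ofHom (Character.comap τ.unop) }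

/-- The canonical morphism `G ⟶ G**`, `g ↦ (χ ↦ χ(g))`. -/
def biduality (G : MonoidFunctor k) : G ⟶ dual (dual G) where
  app B := CommMonCat.ofHom
    { toFun x :=
        { app := fun {C} f =>
            { toFun := fun χ : Character G C => χ.app (𝟙 C) ((G.map f).hom x)
              map_one' := rfl
              map_mul' := fun _ _ => rfl }
          naturality := fun {C D} f g (χ : Character G C) => by
            change χ.app (g ≫ 𝟙 D) ((G.map (f ≫ g)).hom x) = g.hom (χ.app (𝟙 C) _)
            rw [← χ.naturality]
            simp }
      map_one' := Character.ext_app fun {C} f => MonoidHom.ext fun χ => by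
        change Character.app χ (𝟙 C) ((G.map f).hom 1) = 1
        simp
      map_mul' x y := Character.ext_app fun {C} f => MonoidHom.ext fun χ => by
        change Character.app χ (𝟙 C) ((G.map f).hom (x * y)) =
          Character.app χ (𝟙 C) ((G.map f).hom x) * Character.app χ (𝟙 C) ((G.map f).hom y)
        simp }
  naturality B B' h := by
    ext x
    refine Character.ext_app fun {C} f => MonoidHom.ext fun χ => ?_
    change Character.app χ (𝟙 C) ((G.map f).hom ((G.map h).hom x)) =
      Character.app χ (𝟙 C) ((G.map (h ≫ f)).hom x)
    simp

/-! ### The two categories -/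

/-- `G` is the affine `k`-monoid `Spec A`: its underlying functor of sets is the functor of points
of `Spec A`. -/
def IsSpec (G : MonoidFunctor k) (A : CommAlgCat.{u} k) : Prop :=
  Nonempty (G ⋙ forget CommMonCat ≅ points A)

/-- The underlying functor of sets of `H` is `Spec 𝐄*`, for some structure of functor of commutative
`k`-algebras on the functor of `k`-modules `𝐄*`. -/
def IsSpecDual (H : MonoidFunctor k) (E : Type u) [AddCommGroup E] [Module k E] : Prop :=
  ∃ 𝒜 : AlgebraFunctor.{u + 1} k,
    Nonempty (𝒜.toModuleFunctor.Iso (quasiCoherent (k := k) E).dual) ∧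
      Nonempty (H ⋙ forget CommMonCat ≅ spec 𝒜)

/-- Abelian affine `k`-monoids `Spec A` with `A` projective over `k`. -/
def affineMonoids (k : Type u) [CommRing k] : ObjectProperty (MonoidFunctor k) := fun G =>
  ∃ A : CommAlgCat.{u} k, Module.Projective k A ∧ IsSpec G A

/-- Functors `Spec 𝐄*` of abelian monoids with `E` projective over `k`. -/
def specDualMonoids (k : Type u) [CommRing k] : ObjectProperty (MonoidFunctor k) := fun H =>
  ∃ E : ModuleCat.{u} k, Module.Projective k E ∧ IsSpecDual H E

/-- Finite (locally free) commutative `k`-group schemes. -/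
def finiteGroups (k : Type u) [CommRing k] : ObjectProperty (MonoidFunctor k) := fun G =>
  (∃ A : CommAlgCat.{u} k, Module.Finite k A ∧ Module.Projective k A ∧ IsSpec G A) ∧
    ∀ (B : CommAlgCat.{u} k) (x : G.obj B), IsUnit x

/-- The contravariant functor `G ↦ G*` between two full subcategories of functors of abelian
monoids. -/
def dualRestrict {P Q : ObjectProperty (MonoidFunctor k)} (h : ∀ G, P G → Q (dual G)) :
    P.FullSubcategoryᵒᵖ ⥤ Q.FullSubcategory :=
  Q.lift (P.ι.op ⋙ dualFunctor k) fun G => h _ G.unop.property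

/-- `G ↦ G*` maps each of the two full subcategories `P` and `Q` to the other one, the two
contravariant functors so obtained are mutually inverse anti-equivalences, and the canonical
morphism `G ⟶ G**` is an isomorphism for every `G` in `P` or in `Q`. -/
def DualAntiEquivalence (P Q : ObjectProperty (MonoidFunctor k)) : Prop :=
  ∃ (hPQ : ∀ G, P G → Q (dual G)) (hQP : ∀ H, Q H → P (dual H))
    (e : P.FullSubcategoryᵒᵖ ≌ Q.FullSubcategory),
    e.functor = dualRestrict hPQ ∧ e.inverse = (dualRestrict hQP).rightOp ∧
      (∀ G, P G → IsIso (biduality G)) ∧ (∀ H, Q H → IsIso (biduality H))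

end CartierDuality

end

noncomputable section

namespace CartierDuality

variable {k : Type u} [CommRing k]

/-! ### Biduality and pairings -/

/-! Everything is governed by one object: a commutative and cocommutative bialgebra `A`, projective
over `k`. It has two functors of monoids, the points `B ↦ Hom(A, B)` under convolution
(`pointsMonoid`) and the group-like elements of `B ⊗ A` under multiplication (`groupLikeMonoid`),
paired by evaluation. The theorem says that the first functors are exactly the objects of `C₁`, that
the second are exactly those of `C₂`, and that the pairing is perfect on both sides.

For `C₁`, Yoneda suffices: the monoid law of `Spec A` is a comultiplication, and a character over
`B` is determined by its value at the generic point, an element of `B ⊗ A` which multiplicativity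
forces to be group-like (`bijective_transpose_evalPairing`).

For `C₂`, let `E` be projective with an algebra structure on `𝐄*`. Square-zero extensions turn
linear maps into algebra morphisms, so naturality in algebras alone shows that the product on `𝐄*`
is convolution for a comultiplication on `E` (`DualChart.exists_comul`) and that a morphism from
`𝐄*` to `𝐁` is evaluation at an element of `B ⊗ E` (`DualChart.exists_eq_evalAt`). Hence `Spec 𝐄*`
is the functor of group-like elements.

The main difficulty is that this functor need not be representable, so Yoneda is replaced by
`exists_linearMap_of_natural`: every natural function on group-like elements with values in a
quasi-coherent functor is a unique linear map on `E`. The algebra `Hom(E, B)` is cut down by the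
largest ideal vanishing on a finite subset of `E`; the quotient carries a tautological group-like
element, and every group-like element is a specialisation of one of these. Consequently a monoid law
on group-like elements becomes a bialgebra structure on `E` (`GroupLikeChart.exists_bialgebra`), and
a character becomes a linear form which is an algebra morphism (`bijective_evalPairing`).

Since the pairing and its transpose are isomorphisms, biduality is an isomorphism on both sides by
two-out-of-three, and the anti-equivalences follow formally. When `A` is finite, the group-like
elements are represented by the convolution algebra `Hom(A, k)`, which gives Cartier duality. -/

/-- The morphism of duals induced by a morphism of functors of monoids. -/
def dualMap {G G' : MonoidFunctor k} (τ : G ⟶ G') : dual G' ⟶ dual G := (dualFunctor k).map τ.op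

instance {G G' : MonoidFunctor k} (τ : G ⟶ G') [IsIso τ] : IsIso (dualMap τ) :=
  inferInstanceAs (IsIso ((dualFunctor k).map τ.op))

lemma biduality_naturality {G G' : MonoidFunctor k} (τ : G ⟶ G') :
    τ ≫ biduality G' = biduality G ≫ dualMap (dualMap τ) := by
  ext B x
  refine Character.ext_app fun {C} f => MonoidHom.ext fun χ => ?_
  change Character.app χ (𝟙 C) ((G'.map f).hom ((τ.app B).hom x)) =
    Character.app χ (𝟙 C) ((τ.app C).hom ((G.map f).hom x))
  have := congrArg (fun t => t.hom x) (τ.naturality f)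
  simp only [CommMonCat.hom_comp, MonoidHom.comp_apply] at this
  rw [this]

/-- The morphism `H ⟶ G*` attached to a morphism `G ⟶ H*`. -/
def transpose {G H : MonoidFunctor k} (α : G ⟶ dual H) : H ⟶ dual G :=
  biduality H ≫ dualMap α

/-- This is a triangle identity: both sides send `x` to `y ↦ α(x)(y)`. If `α` and its transpose are
invertible, it forces biduality of the source to be invertible too. -/
lemma biduality_comp_transpose {G H : MonoidFunctor k} (α : G ⟶ dual H) :
    biduality G ≫ dualMap (transpose α) = α := by
  ext B x
  refine Character.ext_app fun {C} f => MonoidHom.ext fun y => ?_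
  have hα := congrArg (fun t => t.hom x) (α.naturality f)
  simp only [CommMonCat.hom_comp, MonoidHom.comp_apply] at hα
  change Character.app ((α.app C).hom ((G.map f).hom x)) (𝟙 C) ((H.map (𝟙 C)).hom y) =
    Character.app ((α.app B).hom x) f y
  rw [hα]
  change Character.app ((α.app B).hom x) (f ≫ 𝟙 C) _ = _
  rw [Category.comp_id, H.map_id]
  rfl

lemma isIso_biduality_left {G H : MonoidFunctor k} (α : G ⟶ dual H) [IsIso α]
    [IsIso (transpose α)] : IsIso (biduality G) := by
  have h : IsIso (biduality G ≫ dualMap (transpose α)) := by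
    rw [biduality_comp_transpose]; infer_instance
  exact IsIso.of_isIso_comp_right _ (dualMap (transpose α))

lemma isIso_biduality_right {G H : MonoidFunctor k} (α : G ⟶ dual H) [IsIso α]
    [h : IsIso (transpose α)] : IsIso (biduality H) := by
  unfold transpose at h
  exact IsIso.of_isIso_comp_right _ (dualMap α)

lemma isIso_biduality_of_iso {G G' : MonoidFunctor k} (e : G ≅ G') [IsIso (biduality G')] :
    IsIso (biduality G) := by
  have h : IsIso (biduality G ≫ dualMap (dualMap e.hom)) := by
    rw [← biduality_naturality]; infer_instance
  exact IsIso.of_isIso_comp_right _ (dualMap (dualMap e.hom))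

/-- Isomorphic functors of monoids have isomorphic duals. -/
def dualIso {G G' : MonoidFunctor k} (e : G ≅ G') : dual G ≅ dual G' :=
  (dualFunctor k).mapIso e.symm.op

lemma inv_biduality_naturality {G G' : MonoidFunctor k} (τ : G ⟶ G') [IsIso (biduality G)]
    [IsIso (biduality G')] :
    inv (biduality G) ≫ τ = dualMap (dualMap τ) ≫ inv (biduality G') := by
  rw [IsIso.inv_comp_eq, ← Category.assoc, ← biduality_naturality, Category.assoc,
    IsIso.hom_inv_id, Category.comp_id]

/-- Two properties exchanged by duality, whose objects are reflexive, define anti-equivalent full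
subcategories. -/
lemma DualAntiEquivalence.of_isIso_biduality {P Q : ObjectProperty (MonoidFunctor k)}
    (hPQ : ∀ G, P G → Q (dual G)) (hQP : ∀ H, Q H → P (dual H))
    (hP : ∀ G, P G → IsIso (biduality G)) (hQ : ∀ H, Q H → IsIso (biduality H)) :
    DualAntiEquivalence P Q := by
  -- `Equivalence.mk` adjusts only the unit, so the functor and its inverse are the prescribed ones
  -- by `rfl`.
  refine ⟨hPQ, hQP, CategoryTheory.Equivalence.mk (dualRestrict hPQ) (dualRestrict hQP).rightOp
    (NatIso.ofComponents (fun G => ?_) ?_) (NatIso.ofComponents (fun H => ?_) ?_),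
    rfl, rfl, hP, hQ⟩
  · have := hP _ G.unop.property
    exact (P.isoMk (asIso (biduality G.unop.obj)).symm).op
  · intro G G' τ
    have := hP _ G.unop.property
    have := hP _ G'.unop.property
    apply Quiver.Hom.unop_inj
    apply P.hom_ext
    exact inv_biduality_naturality τ.unop.hom
  · have := hQ _ H.property
    exact Q.isoMk (asIso (biduality H.obj)).symm
  · intro H H' τ
    have := hQ _ H.property
    have := hQ _ H'.property
    apply Q.hom_ext
    exact (inv_biduality_naturality τ.hom).symm

/-! ### Projective modules and functionals -/

section Functionals

variable {E F N : Type*} [AddCommGroup E] [Module k E] [AddCommGroup F] [Module k F]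
  [AddCommGroup N] [Module k N]

/-- A finite dual basis relative to finitely many elements of a projective module. -/
lemma exists_dualBasis [Module.Projective k E] (Y : Finset E) :
    ∃ (T : Finset E) (φ : E → E →ₗ[k] k), ∀ y ∈ Y, y = ∑ l ∈ T, φ l y • l := by
  classical
  obtain ⟨s, hs⟩ := Module.projective_def.mp ‹Module.Projective k E›
  refine ⟨Y.biUnion fun y => (s y).support, fun l => Finsupp.lapply l ∘ₗ s, fun y hy => ?_⟩
  conv_lhs => rw [← hs y, Finsupp.linearCombination_apply, Finsupp.sum]
  refine Finset.sum_subset (Finset.subset_biUnion_of_mem (fun y => (s y).support) hy) ?_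
  intro l _ hl
  simp [Finsupp.notMem_support_iff.mp hl]

/-- A dual basis adapted to the finitely many right-hand legs of `z` expands `z` in terms of its
images under functionals. -/
lemma eq_zero_of_lTensor [Module.Projective k E] {z : N ⊗[k] E}
    (h : ∀ w : E →ₗ[k] k, w.lTensor N z = 0) : z = 0 := by
  classical
  obtain ⟨S, rfl⟩ := TensorProduct.exists_finset z
  obtain ⟨T, φ, hT⟩ := exists_dualBasis (k := k) (S.image Prod.snd)
  calc ∑ i ∈ S, i.1 ⊗ₜ[k] i.2
      = ∑ i ∈ S, i.1 ⊗ₜ[k] ∑ l ∈ T, φ l i.2 • l :=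
        Finset.sum_congr rfl fun i hi => by
          rw [← hT i.2 (Finset.mem_image_of_mem _ hi)]
    _ = ∑ l ∈ T, TensorProduct.rid k N ((φ l).lTensor N (∑ i ∈ S, i.1 ⊗ₜ[k] i.2)) ⊗ₜ[k] l := by
        simp only [TensorProduct.tmul_sum, map_sum, LinearMap.lTensor_tmul,
          TensorProduct.rid_tmul, TensorProduct.sum_tmul]
        rw [Finset.sum_comm]
        simp [TensorProduct.smul_tmul]
    _ = 0 := by simp [h]

lemma eq_of_lTensor [Module.Projective k E] {z z' : N ⊗[k] E}
    (h : ∀ w : E →ₗ[k] k, w.lTensor N z = w.lTensor N z') : z = z' :=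
  sub_eq_zero.mp (eq_zero_of_lTensor fun w => by rw [map_sub, h, sub_self])

/-- After reassociating, the two projective factors are stripped off one at a time. -/
lemma eq_of_lTensor_map [Module.Projective k E] [Module.Projective k F] {z z' : N ⊗[k] (E ⊗[k] F)}
    (h : ∀ (w : E →ₗ[k] k) (w' : F →ₗ[k] k),
      (LinearMap.mul' k k ∘ₗ TensorProduct.map w w').lTensor N z =
        (LinearMap.mul' k k ∘ₗ TensorProduct.map w w').lTensor N z') : z = z' := by
  apply (TensorProduct.assoc k N E F).symm.injective
  refine eq_of_lTensor fun w' => ?_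
  apply (TensorProduct.rid k _).injective
  refine eq_of_lTensor fun w => ?_
  have key : ∀ z : N ⊗[k] (E ⊗[k] F),
      w.lTensor N (TensorProduct.rid k _ (w'.lTensor _ ((TensorProduct.assoc k N E F).symm z))) =
        (LinearMap.mul' k k ∘ₗ TensorProduct.map w w').lTensor N z := by
    intro z
    induction z with
    | zero => simp
    | add x y hx hy => simp only [map_add, hx, hy]
    | tmul n y =>
      induction y with
      | zero => simp
      | add x y hx hy => simp only [map_add, hx, hy, TensorProduct.tmul_add]
      | tmul e f => simp [← TensorProduct.tmul_smul, mul_comm]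
  rw [key, key, h]

end Functionals

/-! ### Extension of scalars and pairings -/

section Pairing

variable {B C D : Type*} [CommRing B] [Algebra k B] [CommRing C] [Algebra k C]
  [CommRing D] [Algebra k D]
  {E F N : Type*} [AddCommGroup E] [Module k E] [AddCommGroup F] [Module k F]
  [AddCommGroup N] [Module k N]

variable (E) in
/-- The map `B ⊗ E → C ⊗ E` induced by a morphism of algebras `B → C`. -/
abbrev extend (f : B →ₐ[k] C) : B ⊗[k] E →ₗ[k] C ⊗[k] E := f.toLinearMap.rTensor E

lemma extend_comp (f : B →ₐ[k] C) (g : C →ₐ[k] D) (z : B ⊗[k] E) :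
    extend E (g.comp f) z = extend E g (extend E f z) := by
  rw [extend, AlgHom.comp_toLinearMap, LinearMap.rTensor_comp_apply]

lemma extend_id (z : B ⊗[k] E) : extend E (AlgHom.id k B) z = z := by
  rw [extend, AlgHom.toLinearMap_id, LinearMap.rTensor_id_apply]

lemma liftBaseChange_extend (f : B →ₐ[k] C) (w : E →ₗ[k] B) (g : B ⊗[k] E) :
    (f.toLinearMap ∘ₗ w).liftBaseChange C (extend E f g) = f (w.liftBaseChange B g) := by
  induction g with
  | zero => simp
  | tmul c e => simp
  | add x y hx hy => simp only [map_add, hx, hy]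

lemma liftBaseChange_add {M : Type*} [AddCommGroup M] [Module k M] [Module B M]
    [IsScalarTower k B M] (v w : E →ₗ[k] M) (g : B ⊗[k] E) :
    (v + w).liftBaseChange B g = v.liftBaseChange B g + w.liftBaseChange B g :=
  congrArg (fun φ => φ g) (map_add (LinearMap.liftBaseChangeEquiv B) v w)

lemma liftBaseChange_smul {M : Type*} [AddCommGroup M] [Module k M] [Module B M]
    [IsScalarTower k B M] (b : B) (w : E →ₗ[k] M) (g : B ⊗[k] E) :
    (b • w).liftBaseChange B g = b • w.liftBaseChange B g :=
  congrArg (fun φ => φ g) (map_smul (LinearMap.liftBaseChangeEquiv B) b w)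

lemma liftBaseChange_algHom_extend {A : Type*} [CommRing A] [Algebra k A] (a : A →ₐ[k] C)
    (f : B →ₐ[k] C) (g : B ⊗[k] A) :
    a.toLinearMap.liftBaseChange C (extend A f g) =
      Algebra.TensorProduct.lift f a (fun _ _ => .all _ _) g := by
  induction g with
  | zero => simp
  | tmul c e => simp
  | add x y hx hy => simp only [map_add, hx, hy]

lemma liftBaseChange_algHom_mul {A : Type*} [CommRing A] [Algebra k A] (a : A →ₐ[k] C)
    (g h : C ⊗[k] A) : a.toLinearMap.liftBaseChange C (g * h) =
      a.toLinearMap.liftBaseChange C g * a.toLinearMap.liftBaseChange C h :=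
  map_mul (a.liftEquiv k C A C) g h

lemma liftBaseChange_algHom_one {A : Type*} [CommRing A] [Algebra k A] (a : A →ₐ[k] C) :
    a.toLinearMap.liftBaseChange C (1 : C ⊗[k] A) = 1 :=
  map_one (a.liftEquiv k C A C)

/-- The external product `(B ⊗ E) × (B ⊗ F) → B ⊗ (E ⊗ F)`. -/
def boxMul : B ⊗[k] E →ₗ[k] B ⊗[k] F →ₗ[k] B ⊗[k] (E ⊗[k] F) :=
  TensorProduct.map₂ (LinearMap.mul k B) (TensorProduct.mk k E F)

@[simp] lemma boxMul_tmul (b c : B) (e : E) (f : F) :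
    boxMul (b ⊗ₜ[k] e) (c ⊗ₜ[k] f) = (b * c) ⊗ₜ[k] (e ⊗ₜ[k] f) := rfl

lemma extend_boxMul (f : B →ₐ[k] C) (g : B ⊗[k] E) (h : B ⊗[k] F) :
    extend (E ⊗[k] F) f (boxMul g h) = boxMul (extend E f g) (extend F f h) := by
  induction g with
  | zero => simp
  | add x y hx hy => simp only [map_add, LinearMap.add_apply, hx, hy]
  | tmul c e =>
    induction h with
    | zero => simp
    | add x y hx hy => simp only [map_add, hx, hy]
    | tmul d e' => simp

lemma liftBaseChange_boxMul (w : E →ₗ[k] B) (w' : F →ₗ[k] B) (g : B ⊗[k] E) (h : B ⊗[k] F) :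
    (LinearMap.mul' k B ∘ₗ TensorProduct.map w w').liftBaseChange B (boxMul g h) =
      w.liftBaseChange B g * w'.liftBaseChange B h := by
  induction g with
  | zero => simp
  | add x y hx hy => simp only [map_add, LinearMap.add_apply, hx, hy, add_mul]
  | tmul c e =>
    induction h with
    | zero => simp
    | add x y hx hy => simp only [map_add, hx, hy, mul_add]
    | tmul d e' => simp; ring

lemma boxMul_eq_mul {A A' : Type*} [CommRing A] [Algebra k A] [CommRing A'] [Algebra k A']
    (g : B ⊗[k] A) (h : B ⊗[k] A') : boxMul g h =
      Algebra.TensorProduct.map (AlgHom.id k B) Algebra.TensorProduct.includeLeft g *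
        Algebra.TensorProduct.map (AlgHom.id k B) Algebra.TensorProduct.includeRight h := by
  induction g with
  | zero => simp
  | add x y hx hy => simp only [map_add, LinearMap.add_apply, hx, hy, add_mul]
  | tmul c e =>
    induction h with
    | zero => simp
    | add x y hx hy => simp only [map_add, hx, hy, mul_add]
    | tmul d e' => simp

/-- A linear form with values in `k`, seen with values in `B`. -/
abbrev scalarForm (B : Type*) [CommRing B] [Algebra k B] (w : E →ₗ[k] k) : E →ₗ[k] B :=
  Algebra.linearMap k B ∘ₗ w

lemma scalarForm_comp (f : B →ₐ[k] C) (w : E →ₗ[k] k) :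
    f.toLinearMap ∘ₗ scalarForm B w = scalarForm C w := by ext; simp

lemma liftBaseChange_scalarForm (w : E →ₗ[k] k) (g : B ⊗[k] E) :
    (scalarForm B w).liftBaseChange B g = TensorProduct.rid k B (w.lTensor B g) := by
  induction g with
  | zero => simp
  | add x y hx hy => simp only [map_add, hx, hy]
  | tmul c e => simp [Algebra.smul_def, mul_comm]

lemma liftBaseChange_lTensor {M : Type*} [AddCommGroup M] [Module k M] [Module B M]
    [IsScalarTower k B M] (w : F →ₗ[k] M) (φ : E →ₗ[k] F) (g : B ⊗[k] E) :
    w.liftBaseChange B (φ.lTensor B g) = (w ∘ₗ φ).liftBaseChange B g := by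
  induction g with
  | zero => simp
  | add x y hx hy => simp only [map_add, hx, hy]
  | tmul c e => simp

lemma extend_lTensor (f : B →ₐ[k] C) (φ : E →ₗ[k] F) (g : B ⊗[k] E) :
    extend F f (φ.lTensor B g) = φ.lTensor C (extend E f g) := by
  simp only [← LinearMap.comp_apply, LinearMap.rTensor_comp_lTensor, LinearMap.lTensor_comp_rTensor]

/-- A functional of `N` may be applied before or after pairing with `p`; this reduces `N`-valued
statements to scalar ones. -/
lemma liftBaseChange_comp_scalarForm (ν : N →ₗ[k] k) (v : E →ₗ[k] B ⊗[k] N) (f : B →ₐ[k] C)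
    (p : C ⊗[k] E) :
    (f.toLinearMap ∘ₗ ((scalarForm B ν).liftBaseChange B).restrictScalars k ∘ₗ
        v).liftBaseChange C p =
      (scalarForm C ν).liftBaseChange C ((extend N f ∘ₗ v).liftBaseChange C p) := by
  induction p with
  | zero => simp
  | add x y hx hy => simp only [map_add, hx, hy]
  | tmul c e =>
    simp only [LinearMap.liftBaseChange_tmul, LinearMap.comp_apply, map_smul]
    rw [← scalarForm_comp f, liftBaseChange_extend]
    rfl

/-- Partial evaluation of a linear map on `E ⊗ F` at an element of `C ⊗ F`. -/
def partialEval {M : Type*} [AddCommGroup M] [Module k M] [Module C M] [IsScalarTower k C M]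
    (v : E ⊗[k] F →ₗ[k] M) (q : C ⊗[k] F) : E →ₗ[k] M where
  toFun x := (v ∘ₗ TensorProduct.mk k E F x).liftBaseChange C q
  map_add' x y := by rw [map_add, LinearMap.comp_add, liftBaseChange_add]
  map_smul' a x := by
    rw [map_smul, LinearMap.comp_smul, ← algebraMap_smul C a, liftBaseChange_smul,
      algebraMap_smul, RingHom.id_apply]

lemma partialEval_apply {M : Type*} [AddCommGroup M] [Module k M] [Module C M]
    [IsScalarTower k C M] (v : E ⊗[k] F →ₗ[k] M) (q : C ⊗[k] F) (x : E) :
    partialEval v q x = (v ∘ₗ TensorProduct.mk k E F x).liftBaseChange C q := rfl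

/-- A Fubini rule: pairing with an external product is done one variable at a time. -/
lemma liftBaseChange_boxMul_eq {M : Type*} [AddCommGroup M] [Module k M] [Module C M]
    [IsScalarTower k C M] (v : E ⊗[k] F →ₗ[k] M) (p : C ⊗[k] E) (q : C ⊗[k] F) :
    v.liftBaseChange C (boxMul p q) = (partialEval v q).liftBaseChange C p := by
  induction p with
  | zero => simp
  | add x y hx hy => simp only [map_add, LinearMap.add_apply, hx, hy]
  | tmul c e =>
    induction q with
    | zero => simp [partialEval_apply]
    | add x y hx hy =>
      simp only [map_add, hx, hy, LinearMap.liftBaseChange_tmul, partialEval_apply, smul_add]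
    | tmul d e' => simp [partialEval_apply, mul_smul]

lemma comp_partialEval (f : B →ₐ[k] C) (v : E ⊗[k] F →ₗ[k] B) (q : B ⊗[k] F) :
    f.toLinearMap ∘ₗ partialEval v q = partialEval (f.toLinearMap ∘ₗ v) (extend F f q) := by
  ext x
  exact (liftBaseChange_extend f (v ∘ₗ TensorProduct.mk k E F x) q).symm

lemma eq_of_scalarForm [Module.Projective k E] {z z' : B ⊗[k] E}
    (h : ∀ w : E →ₗ[k] k, (scalarForm B w).liftBaseChange B z =
      (scalarForm B w).liftBaseChange B z') : z = z' :=
  eq_of_lTensor fun w => (TensorProduct.rid k B).injective <| by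
    rw [← liftBaseChange_scalarForm, ← liftBaseChange_scalarForm, h]

end Pairing

/-! ### Group-like elements -/

section GroupLike

open Coalgebra

variable {B C D : Type*} [CommRing B] [Algebra k B] [CommRing C] [Algebra k C]
  [CommRing D] [Algebra k D]
  {E N : Type*} [AddCommGroup E] [Module k E] [Coalgebra k E] [AddCommGroup N] [Module k N]

/-- Group-like elements of `B ⊗ E`, for a `k`-coalgebra `E`. -/
structure IsGroupLike (g : B ⊗[k] E) : Prop where
  comul_eq : (comul (R := k) (A := E)).lTensor B g = boxMul g g
  counit_eq : (scalarForm B (counit (R := k) (A := E))).liftBaseChange B g = 1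

lemma IsGroupLike.extend {g : B ⊗[k] E} (hg : IsGroupLike g) (f : B →ₐ[k] C) :
    IsGroupLike (extend E f g) where
  comul_eq := by rw [← extend_lTensor, hg.comul_eq, extend_boxMul]
  counit_eq := by
    have : scalarForm C (counit (R := k) (A := E)) =
        f.toLinearMap ∘ₗ scalarForm B (counit (R := k) (A := E)) := by ext; simp
    rw [this, liftBaseChange_extend, hg.counit_eq, map_one]

/-- The convolution product of linear maps from a coalgebra to an algebra. -/
def conv (v w : E →ₗ[k] B) : E →ₗ[k] B :=
  LinearMap.mul' k B ∘ₗ TensorProduct.map v w ∘ₗ comul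

lemma conv_apply (v w : E →ₗ[k] B) (x : E) :
    conv v w x = LinearMap.mul' k B (TensorProduct.map v w (comul x)) := rfl

lemma comp_conv (f : B →ₐ[k] C) (v w : E →ₗ[k] B) :
    f.toLinearMap ∘ₗ conv v w = conv (f.toLinearMap ∘ₗ v) (f.toLinearMap ∘ₗ w) :=
  LinearMap.algHom_comp_convMul_distrib f (WithConv.toConv v) (WithConv.toConv w)

lemma scalarForm_conv (B : Type*) [CommRing B] [Algebra k B] (v w : E →ₗ[k] k) :
    scalarForm B (conv v w) = conv (scalarForm B v) (scalarForm B w) :=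
  comp_conv (Algebra.ofId k B) v w

lemma IsGroupLike.liftBaseChange_conv {g : B ⊗[k] E} (hg : IsGroupLike g) (v w : E →ₗ[k] B) :
    (conv v w).liftBaseChange B g = v.liftBaseChange B g * w.liftBaseChange B g := by
  rw [← liftBaseChange_boxMul, ← hg.comul_eq, liftBaseChange_lTensor]
  rfl

/-- Products of functionals defined over `k` separate `B ⊗ (E ⊗ E)`, so multiplicativity of the
pairing with `g` needs testing only on forms with values in `k`. -/
lemma isGroupLike_of_scalarForm [Module.Projective k E] {g : B ⊗[k] E}
    (h1 : (scalarForm B (counit (R := k) (A := E))).liftBaseChange B g = 1)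
    (hmul : ∀ v w : E →ₗ[k] k, (scalarForm B (conv v w)).liftBaseChange B g =
      (scalarForm B v).liftBaseChange B g * (scalarForm B w).liftBaseChange B g) :
    IsGroupLike g where
  counit_eq := h1
  comul_eq := by
    refine eq_of_lTensor_map fun v w => (TensorProduct.rid k B).injective ?_
    rw [← liftBaseChange_scalarForm, ← liftBaseChange_scalarForm, liftBaseChange_lTensor]
    refine (hmul v w).trans ?_
    rw [← liftBaseChange_boxMul]
    congr 2
    ext
    simp

end GroupLike

/-! ### Functions on the functor of group-like elements -/

section Quotients

set_option linter.unusedSectionVars false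

open Coalgebra

variable {B C D : Type*} [CommRing B] [Algebra k B] [CommRing C] [Algebra k C]
  {E : Type*} [AddCommGroup E] [Module k E] [Coalgebra k E] [IsCocomm k E]

variable (k B E) in
/-- The algebra of linear maps from `E` to `B` with the convolution product. -/
def ConvAlg : Type _ := WithConv (E →ₗ[k] B)

namespace ConvAlg

instance : CommRing (ConvAlg k B E) := inferInstanceAs (CommRing (WithConv (E →ₗ[k] B)))

instance : Algebra B (ConvAlg k B E) := inferInstanceAs (Algebra B (WithConv (E →ₗ[k] B)))

instance : Algebra k (ConvAlg k B E) := inferInstanceAs (Algebra k (WithConv (E →ₗ[k] B)))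

instance : IsScalarTower k B (ConvAlg k B E) :=
  ⟨fun a b w => WithConv.ext (LinearMap.ext fun x => smul_assoc a b (w.ofConv x))⟩

variable (k B E) in
/-- The linear identification of `Hom(E, B)` with the convolution algebra. -/
def of : (E →ₗ[k] B) ≃ₗ[B] ConvAlg k B E := (WithConv.linearEquiv B (E →ₗ[k] B)).symm

/-- The linear map underlying an element of the convolution algebra. -/
abbrev lin (w : ConvAlg k B E) : E →ₗ[k] B := (of k B E).symm w

@[simp] lemma lin_mul (v w : ConvAlg k B E) : (v * w).lin = conv v.lin w.lin := rfl

@[simp] lemma lin_one : (1 : ConvAlg k B E).lin = scalarForm B counit := rfl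

lemma lin_add (v w : ConvAlg k B E) : (v + w).lin = v.lin + w.lin := rfl

lemma lin_smul' (a : k) (w : ConvAlg k B E) : (a • w).lin = a • w.lin := rfl

lemma lin_algebraMap (b : B) : (algebraMap B (ConvAlg k B E) b).lin = b • scalarForm B counit := by
  rw [Algebra.algebraMap_eq_smul_one]; rfl

end ConvAlg

variable (B) in
/-- The largest ideal of the convolution algebra `Hom(E, B)` whose elements vanish on `S`. -/
def vanishingIdeal (S : Set E) : Ideal (ConvAlg k B E) where
  carrier := {w | ∀ v : ConvAlg k B E, ∀ x ∈ S, (v * w).lin x = 0}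
  zero_mem' v x _ := by simp
  add_mem' {a b} ha hb v x hx := by
    rw [mul_add, ConvAlg.lin_add, LinearMap.add_apply, ha v x hx, hb v x hx, add_zero]
  smul_mem' c w hw v x hx := by
    rw [smul_eq_mul, ← mul_assoc]
    exact hw _ x hx

lemma apply_eq_zero_of_mem_vanishingIdeal {S : Set E} {w : ConvAlg k B E}
    (hw : w ∈ vanishingIdeal B S) {x : E} (hx : x ∈ S) : w.lin x = 0 := by
  simpa only [one_mul] using hw 1 x hx

lemma vanishingIdeal_anti {S T : Set E} (h : S ⊆ T) :
    vanishingIdeal (k := k) B T ≤ vanishingIdeal B S := fun _ hw v x hx => hw v x (h hx)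

variable (k B) in
/-- The quotient of the convolution algebra `Hom(E, B)` by `vanishingIdeal B S`. -/
def Truncation (S : Set E) : Type _ := ConvAlg k B E ⧸ vanishingIdeal (k := k) B S

namespace Truncation

variable {S T : Set E}

instance : CommRing (Truncation k B S) :=
  inferInstanceAs (CommRing (ConvAlg k B E ⧸ vanishingIdeal (k := k) B S))

instance : Algebra k (Truncation k B S) :=
  inferInstanceAs (Algebra k (ConvAlg k B E ⧸ vanishingIdeal (k := k) B S))

variable (k B S) in
/-- The quotient map onto a truncation. -/
def proj : ConvAlg k B E →ₐ[k] Truncation k B S :=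
  Ideal.Quotient.mkₐ k (vanishingIdeal B S)

lemma proj_surjective : Function.Surjective (proj k B S) :=
  Ideal.Quotient.mkₐ_surjective k (vanishingIdeal B S)

lemma proj_eq_proj {v w : ConvAlg k B E} :
    proj k B S v = proj k B S w ↔ v - w ∈ vanishingIdeal B S :=
  Ideal.Quotient.mk_eq_mk_iff_sub_mem v w

/-- Morphisms of algebras out of a truncation. -/
def lift (f : ConvAlg k B E →ₐ[k] C) (h : ∀ w ∈ vanishingIdeal B S, f w = 0) :
    Truncation k B S →ₐ[k] C := Ideal.Quotient.liftₐ (vanishingIdeal B S) f h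

@[simp] lemma lift_proj (f : ConvAlg k B E →ₐ[k] C) (h : ∀ w ∈ vanishingIdeal B S, f w = 0)
    (w : ConvAlg k B E) : lift f h (proj k B S w) = f w := rfl

/-- Elements of the ideal vanish on `S`, so the value at a point of `S` does not depend on the
representative; this makes `eval` linear. -/
lemma apply_surjInv {x : E} (hx : x ∈ S) (w : ConvAlg k B E) :
    (Function.surjInv (proj_surjective (S := S)) (proj k B S w)).lin x = w.lin x := by
  have := proj_eq_proj.mp (Function.surjInv_eq (proj_surjective (S := S)) (proj k B S w))
  exact sub_eq_zero.mp (apply_eq_zero_of_mem_vanishingIdeal this hx)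

/-- Evaluation at an element of `S`. -/
def eval {x : E} (hx : x ∈ S) : Truncation k B S →ₗ[k] B where
  toFun q := (Function.surjInv (proj_surjective (S := S)) q).lin x
  map_add' p q := by
    obtain ⟨v, rfl⟩ := proj_surjective p
    obtain ⟨w, rfl⟩ := proj_surjective q
    rw [← map_add, apply_surjInv hx, apply_surjInv hx, apply_surjInv hx]
    rfl
  map_smul' a q := by
    obtain ⟨w, rfl⟩ := proj_surjective q
    rw [← map_smul, apply_surjInv hx, apply_surjInv hx]
    rfl

@[simp] lemma eval_proj {x : E} (hx : x ∈ S) (w : ConvAlg k B E) :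
    eval hx (proj k B S w) = w.lin x := apply_surjInv hx w

variable (k B) in
/-- The restriction map between truncations. -/
def restrict (h : S ⊆ T) : Truncation k B T →ₐ[k] Truncation k B S :=
  lift (proj k B S) fun w hw => by
    rw [← map_zero (proj k B S), proj_eq_proj, sub_zero]
    exact vanishingIdeal_anti h hw

@[simp] lemma restrict_proj (h : S ⊆ T) (w : ConvAlg k B E) :
    restrict k B h (proj k B T w) = proj k B S w := rfl

variable (k B S) in
/-- The structural morphism of `Truncation k B S`. -/
def ofBase : B →ₐ[k] Truncation k B S :=
  (proj k B S).comp ((Algebra.ofId B (ConvAlg k B E)).restrictScalars k)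

lemma ofBase_apply (b : B) : ofBase k B S b = proj k B S (algebraMap B _ b) := rfl

-- The universal element would be the identity of `E`, an infinite sum in general. Modulo the ideal,
-- only the finitely many right legs of `comul x`, for `x ∈ S`, matter, and a finite dual basis for
-- them is enough.
variable (k B) in
lemma exists_point [Module.Projective k E] (hS : S.Finite) :
    ∃ g : Truncation k B S ⊗[k] E, ∀ w : E →ₗ[k] B,
      ((ofBase k B S).toLinearMap ∘ₗ w).liftBaseChange _ g = proj k B S (ConvAlg.of k B E w) := by
  classical
  choose R hR using fun x : E => TensorProduct.exists_finset (comul (R := k) x)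
  obtain ⟨T, φ, hT⟩ := exists_dualBasis (k := k)
    (hS.toFinset.biUnion fun x => (R x).image Prod.snd)
  refine ⟨∑ l ∈ T, proj k B S (ConvAlg.of k B E (scalarForm B (φ l))) ⊗ₜ[k] l, fun w => ?_⟩
  have h1 : ((ofBase k B S).toLinearMap ∘ₗ w).liftBaseChange _ (∑ l ∈ T,
      proj k B S (ConvAlg.of k B E (scalarForm B (φ l))) ⊗ₜ[k] l) =
      proj k B S (∑ l ∈ T, w l • ConvAlg.of k B E (scalarForm B (φ l))) := by
    rw [map_sum, map_sum]
    refine Finset.sum_congr rfl fun l _ => ?_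
    rw [LinearMap.liftBaseChange_tmul, smul_eq_mul, LinearMap.comp_apply, AlgHom.toLinearMap_apply,
      ofBase_apply, ← map_mul, mul_comm, ← Algebra.smul_def]
  rw [h1, eq_comm, proj_eq_proj]
  intro v x hx
  rw [ConvAlg.lin_mul, conv_apply, hR x, map_sum, map_sum]
  refine Finset.sum_eq_zero fun i hi => ?_
  -- The difference vanishes on every right leg of `comul x`, because the dual basis reproduces it;
  -- so each term of the convolution product at `x` is zero.
  have hi' := hT i.2 (Finset.mem_biUnion.mpr ⟨x, by simpa using hx, Finset.mem_image_of_mem _ hi⟩)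
  have : (ConvAlg.of k B E w -
      ∑ l ∈ T, w l • ConvAlg.of k B E (scalarForm B (φ l))).lin i.2 = 0 := by
    simp only [ConvAlg.lin, map_sub, map_sum, map_smul, LinearEquiv.symm_apply_apply,
      LinearMap.sub_apply, LinearMap.sum_apply, LinearMap.smul_apply, LinearMap.comp_apply,
      Algebra.linearMap_apply]
    conv_lhs => enter [1]; rw [hi']
    simp [Algebra.smul_def, mul_comm]
  rw [TensorProduct.map_tmul, this, TensorProduct.tmul_zero, map_zero]

variable (k B) in
/-- The tautological point of `E` with values in `Truncation k B S`. -/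
def point [Module.Projective k E] (hS : S.Finite) :
    Truncation k B S ⊗[k] E := (exists_point k B hS).choose

lemma liftBaseChange_point [Module.Projective k E] (hS : S.Finite) (w : E →ₗ[k] B) :
    ((ofBase k B S).toLinearMap ∘ₗ w).liftBaseChange _ (point k B hS) =
      proj k B S (ConvAlg.of k B E w) :=
  (exists_point k B hS).choose_spec w

lemma scalarForm_point [Module.Projective k E] (hS : S.Finite) (w : E →ₗ[k] k) :
    (scalarForm _ w).liftBaseChange _ (point k B hS) =
      proj k B S (ConvAlg.of k B E (scalarForm B w)) := by
  rw [← scalarForm_comp (ofBase k B S), liftBaseChange_point]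

/-- Pairing with the point is the quotient map, which is multiplicative and unital for convolution.
-/
lemma isGroupLike_point [Module.Projective k E] (hS : S.Finite) :
    IsGroupLike (point k B hS) := by
  refine isGroupLike_of_scalarForm ?_ fun v w => ?_
  · rw [scalarForm_point]
    exact map_one (proj k B S)
  · rw [scalarForm_point, scalarForm_point, scalarForm_point, scalarForm_conv, ← map_mul]
    rfl

lemma extend_restrict_point [Module.Projective k E] (hS : S.Finite) (hT : T.Finite) (h : S ⊆ T) :
    extend E (restrict k B h) (point k B hT) = point k B hS := by
  refine eq_of_scalarForm fun w => ?_
  rw [scalarForm_point, ← scalarForm_comp (restrict k B h), liftBaseChange_extend,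
    scalarForm_point, restrict_proj]

end Truncation

/-- The morphism of algebras `Hom(E, B) → C` attached to a group-like element of `C ⊗ E`. -/
def IsGroupLike.toAlgHom (f : B →ₐ[k] C) {p : C ⊗[k] E} (hp : IsGroupLike p) :
    ConvAlg k B E →ₐ[k] C :=
  AlgHom.ofLinearMap
    { toFun := fun w => (f.toLinearMap ∘ₗ w.lin).liftBaseChange C p
      map_add' := fun v w => by
        rw [ConvAlg.lin_add, LinearMap.comp_add, liftBaseChange_add]
      map_smul' := fun a w => by
        rw [ConvAlg.lin_smul', LinearMap.comp_smul, ← algebraMap_smul C a, liftBaseChange_smul,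
          RingHom.id_apply, algebraMap_smul] }
    (by
      change (f.toLinearMap ∘ₗ (1 : ConvAlg k B E).lin).liftBaseChange C p = 1
      rw [ConvAlg.lin_one, scalarForm_comp, hp.counit_eq])
    (fun v w => by
      change (f.toLinearMap ∘ₗ (v * w).lin).liftBaseChange C p = _
      rw [ConvAlg.lin_mul, comp_conv, hp.liftBaseChange_conv]
      rfl)

lemma IsGroupLike.toAlgHom_apply (f : B →ₐ[k] C) {p : C ⊗[k] E} (hp : IsGroupLike p)
    (w : ConvAlg k B E) :
    hp.toAlgHom f w = (f.toLinearMap ∘ₗ w.lin).liftBaseChange C p := rfl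

lemma IsGroupLike.toAlgHom_algebraMap (f : B →ₐ[k] C) {p : C ⊗[k] E} (hp : IsGroupLike p)
    (b : B) : hp.toAlgHom f (algebraMap B _ b) = f b := by
  have h : f.toLinearMap ∘ₗ (b • scalarForm B (counit (R := k) (A := E))) =
      f b • scalarForm C (counit (R := k) (A := E)) := by
    ext x
    simp
  rw [hp.toAlgHom_apply, ConvAlg.lin_algebraMap, h, liftBaseChange_smul, hp.counit_eq, smul_eq_mul,
    mul_one]

/-- The versal property: once the evaluation at `p` kills the ideal, `p` is a specialisation of the
tautological point. -/
lemma Truncation.extend_lift_point [Module.Projective k E] (f : B →ₐ[k] C) {p : C ⊗[k] E}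
    (hp : IsGroupLike p) {S : Set E} (hfin : S.Finite)
    (hS : ∀ w ∈ vanishingIdeal B S, hp.toAlgHom f w = 0) :
    extend E (lift (hp.toAlgHom f) hS) (point k B hfin) = p := by
  refine eq_of_scalarForm fun w => ?_
  rw [← scalarForm_comp (lift (hp.toAlgHom f) hS), liftBaseChange_extend,
    scalarForm_point, lift_proj, scalarForm_comp (lift (hp.toAlgHom f) hS),
    hp.toAlgHom_apply, ConvAlg.lin, LinearEquiv.symm_apply_apply, scalarForm_comp f]

end Quotients

/-! ### Density: natural functions on group-like elements are linear -/

section Functions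

open Coalgebra

/-- The set of group-like elements of `B ⊗ E`. -/
def GroupLikes (B : Type*) [CommRing B] [Algebra k B] (E : Type*) [AddCommGroup E] [Module k E]
    [Coalgebra k E] : Type _ := {g : B ⊗[k] E // IsGroupLike g}

/-- Extension of scalars for group-like elements. -/
def GroupLikes.map {B C E : Type*} [CommRing B] [Algebra k B] [CommRing C] [Algebra k C]
    [AddCommGroup E] [Module k E] [Coalgebra k E] (f : B →ₐ[k] C) (p : GroupLikes (k := k) B E) :
    GroupLikes (k := k) C E := ⟨extend E f p.1, p.2.extend f⟩

variable {E N : Type u} [AddCommGroup E] [Module k E] [Coalgebra k E] [IsCocomm k E]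
  [Module.Projective k E] [AddCommGroup N] [Module k N] {B : CommAlgCat.{u} k}

namespace Truncation

variable {S T : Set E}

variable (B S) in
/-- A truncation as a commutative algebra. -/
abbrev alg : CommAlgCat.{u} k := CommAlgCat.of k (Truncation k B S)

variable (B S) in
/-- The structural morphism of a truncation. -/
abbrev baseHom : B ⟶ alg B S := CommAlgCat.ofHom (ofBase k B S)

variable (B) in
/-- The tautological point of a truncation. -/
abbrev groupLike (hS : S.Finite) : GroupLikes (k := k) (alg B S) E :=
  ⟨point k B hS, isGroupLike_point hS⟩

lemma groupLike_map_restrict (hS : S.Finite) (hT : T.Finite) (h : S ⊆ T) :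
    (groupLike B hT).map (restrict k B h) = groupLike B hS :=
  Subtype.ext (extend_restrict_point hS hT h)

end Truncation

open Truncation in
/-- Functions on the functor of group-like elements with values in a quasi-coherent functor are
linear. -/
theorem exists_linearMap_of_natural
    (Φ : ∀ {C : CommAlgCat.{u} k}, (B ⟶ C) → GroupLikes (k := k) C E → C ⊗[k] N)
    (hΦ : ∀ {C D : CommAlgCat.{u} k} (f : B ⟶ C) (g : C ⟶ D) (p : GroupLikes (k := k) C E),
      Φ (f ≫ g) (p.map g.hom) = extend N g.hom (Φ f p)) :
    ∃ w : E →ₗ[k] B ⊗[k] N, ∀ {C : CommAlgCat.{u} k} (f : B ⟶ C) (p : GroupLikes (k := k) C E),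
      Φ f p = (extend N f.hom ∘ₗ w).liftBaseChange C p.1 := by
  classical
  -- The candidate value at `x` is the `x`-coordinate of `Φ` at the tautological point. By `hψ` it
  -- does not depend on the finite set `S` containing `x`.
  let ψ (S : Set E) (hS : S.Finite) (x : E) (hx : x ∈ S) : B ⊗[k] N :=
    (eval hx).rTensor N (Φ (baseHom B S) (groupLike B hS))
  have hψ : ∀ (S T : Set E) (hS : S.Finite) (hT : T.Finite) (h : S ⊆ T) (x : E) (hx : x ∈ S),
      ψ S hS x hx = ψ T hT x (h hx) := by
    intro S T hS hT h x hx
    have h1 := hΦ (baseHom B T) (CommAlgCat.ofHom (restrict k B h)) (groupLike B hT)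
    rw [CommAlgCat.hom_ofHom, groupLike_map_restrict hS hT h] at h1
    have h2 : eval (k := k) (B := B) hx ∘ₗ (restrict k B h).toLinearMap = eval (h hx) := by
      refine LinearMap.ext fun q => ?_
      obtain ⟨w, rfl⟩ := proj_surjective q
      simp
    change (eval hx).rTensor N (Φ (baseHom B T ≫ CommAlgCat.ofHom (restrict k B h)) _) = _
    rw [h1, extend, ← LinearMap.rTensor_comp_apply, h2]
  let w : E →ₗ[k] B ⊗[k] N :=
    { toFun := fun x => ψ {x} (Set.finite_singleton x) x (Set.mem_singleton x)
      map_add' := fun x y => by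
        -- Additivity is read off in one truncation that sees all three elements.
        have hS : ({x, y, x + y} : Set E).Finite := Set.toFinite _
        have hx : x ∈ ({x, y, x + y} : Set E) := by simp
        have hy : y ∈ ({x, y, x + y} : Set E) := by simp
        have hxy : x + y ∈ ({x, y, x + y} : Set E) := by simp
        rw [hψ _ _ _ hS (Set.singleton_subset_iff.mpr hx), hψ _ _ _ hS
          (Set.singleton_subset_iff.mpr hy), hψ _ _ _ hS (Set.singleton_subset_iff.mpr hxy)]
        have : eval (k := k) (B := B) hxy = eval hx + eval hy := by
          refine LinearMap.ext fun q => ?_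
          obtain ⟨w, rfl⟩ := proj_surjective q
          simp
        simp only [ψ, this, LinearMap.rTensor_add, LinearMap.add_apply]
      map_smul' := fun a x => by
        have hS : ({x, a • x} : Set E).Finite := Set.toFinite _
        have hx : x ∈ ({x, a • x} : Set E) := by simp
        have hax : a • x ∈ ({x, a • x} : Set E) := by simp
        rw [hψ _ _ _ hS (Set.singleton_subset_iff.mpr hx),
          hψ _ _ _ hS (Set.singleton_subset_iff.mpr hax)]
        have : eval (k := k) (B := B) hax = a • eval hx := by
          refine LinearMap.ext fun q => ?_
          obtain ⟨w, rfl⟩ := proj_surjective q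
          simp
        simp only [ψ, this, LinearMap.rTensor_smul, LinearMap.smul_apply, RingHom.id_apply] }
  refine ⟨w, fun {C} f p => ?_⟩
  obtain ⟨p, hp⟩ := p
  obtain ⟨R, hR⟩ := TensorProduct.exists_finset p
  set S : Set E := Prod.snd '' (R : Set (C × E)) with hSdef
  have hS : S.Finite := R.finite_toSet.image _
  have hmem : ∀ i ∈ R, i.2 ∈ S := fun i hi => ⟨i, hi, rfl⟩
  -- In coordinates, evaluation at `p` uses only values on the right legs of `p`; with `S` the set
  -- of these legs, it kills the vanishing ideal.
  have hpair : ∀ v : ConvAlg k B E,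
      hp.toAlgHom f.hom v = ∑ i ∈ R, i.1 * f.hom (v.lin i.2) := by
    intro v
    rw [hp.toAlgHom_apply, hR, map_sum]
    rfl
  have hI : ∀ v ∈ vanishingIdeal B S, hp.toAlgHom f.hom v = 0 := by
    intro v hv
    rw [hpair]
    refine Finset.sum_eq_zero fun i hi => ?_
    rw [apply_eq_zero_of_mem_vanishingIdeal hv (hmem i hi), map_zero, mul_zero]
  have hcomp : baseHom B S ≫ CommAlgCat.ofHom (lift (hp.toAlgHom f.hom) hI) = f := by
    ext b
    exact hp.toAlgHom_algebraMap f.hom b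
  have hpt : (groupLike B hS).map (lift (hp.toAlgHom f.hom) hI) = ⟨p, hp⟩ :=
    Subtype.ext (extend_lift_point f.hom hp hS hI)
  have key := hΦ (baseHom B S) (CommAlgCat.ofHom (lift (hp.toAlgHom f.hom) hI)) (groupLike B hS)
  rw [hcomp, CommAlgCat.hom_ofHom, hpt] at key
  rw [key]
  -- The specialisation map is a combination of the coordinates `eval`, so applying it to `Φ` of the
  -- tautological point produces the values of `w` at the legs of `p`.
  have hz : ∀ z : Truncation k B S ⊗[k] N, extend N (lift (hp.toAlgHom f.hom) hI) z =
      ∑ i ∈ R.attach, i.1.1 • extend N f.hom ((eval (hmem i.1 i.2)).rTensor N z) := by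
    intro z
    induction z with
    | zero => simp
    | add x y hx hy => simp only [map_add, hx, hy, smul_add, Finset.sum_add_distrib]
    | tmul q n =>
      obtain ⟨v, rfl⟩ := proj_surjective q
      simp only [LinearMap.rTensor_tmul, AlgHom.toLinearMap_apply, lift_proj, eval_proj,
        TensorProduct.smul_tmul', smul_eq_mul, hpair, ← TensorProduct.sum_tmul]
      rw [← Finset.sum_attach]
  rw [hz]
  conv_rhs => enter [2]; change p; rw [hR]
  rw [map_sum, ← Finset.sum_attach R]
  refine Finset.sum_congr rfl fun i _ => ?_
  rw [LinearMap.liftBaseChange_tmul, LinearMap.comp_apply]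
  congr 2
  exact (hψ _ _ _ hS (Set.singleton_subset_iff.mpr (hmem i.1 i.2)) _ (Set.mem_singleton _)).symm

open Truncation in
/-- A linear form is determined by its values on group-like elements. -/
lemma linearMap_ext_groupLikes {v w : E →ₗ[k] B}
    (h : ∀ {C : CommAlgCat.{u} k} (f : B ⟶ C) (p : GroupLikes (k := k) C E),
      (f.hom.toLinearMap ∘ₗ v).liftBaseChange C p.1 =
        (f.hom.toLinearMap ∘ₗ w).liftBaseChange C p.1) : v = w := by
  ext x
  have hx : x ∈ ({x} : Set E) := rfl
  -- The tautological point for `{x}` remembers the value at `x`.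
  have := h (baseHom B {x}) (groupLike B (Set.finite_singleton x))
  have h2 : proj k B {x} (ConvAlg.of k B E v) = proj k B {x} (ConvAlg.of k B E w) := by
    rw [← liftBaseChange_point (Set.finite_singleton x),
      ← liftBaseChange_point (Set.finite_singleton x)]
    exact this
  simpa using congrArg (eval hx) h2

lemma linearMap_ext_groupLikes' [Module.Projective k N] {v w : E →ₗ[k] B ⊗[k] N}
    (h : ∀ {C : CommAlgCat.{u} k} (f : B ⟶ C) (p : GroupLikes (k := k) C E),
      (extend N f.hom ∘ₗ v).liftBaseChange C p.1 =
        (extend N f.hom ∘ₗ w).liftBaseChange C p.1) : v = w := by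
  refine LinearMap.ext fun x => eq_of_scalarForm fun ν => ?_
  have := linearMap_ext_groupLikes (v := ((scalarForm B ν).liftBaseChange B).restrictScalars k ∘ₗ v)
    (w := ((scalarForm B ν).liftBaseChange B).restrictScalars k ∘ₗ w) fun f p => by
      rw [liftBaseChange_comp_scalarForm, liftBaseChange_comp_scalarForm, h]
  exact congrArg (fun φ => φ x) this

end Functions

/-! ### Linear maps on tensor products of coalgebras -/

section TensorExt

open Coalgebra

variable {E F : Type u} [AddCommGroup E] [Module k E] [Coalgebra k E] [IsCocomm k E]
  [Module.Projective k E] [AddCommGroup F] [Module k F] [Coalgebra k F] [IsCocomm k F]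
  [Module.Projective k F] {B : CommAlgCat.{u} k}

/-- The one-variable density is used twice: with `q` fixed, the partial evaluations agree as maps on
`E`; evaluated at `x`, this gives agreement in `q`. -/
lemma linearMap_ext_boxMul {v w : E ⊗[k] F →ₗ[k] B}
    (h : ∀ {C : CommAlgCat.{u} k} (f : B ⟶ C) (p : GroupLikes (k := k) C E)
      (q : GroupLikes (k := k) C F),
      (f.hom.toLinearMap ∘ₗ v).liftBaseChange C (boxMul p.1 q.1) =
        (f.hom.toLinearMap ∘ₗ w).liftBaseChange C (boxMul p.1 q.1)) : v = w := by
  refine TensorProduct.ext' fun x y => ?_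
  have h1 : v ∘ₗ TensorProduct.mk k E F x = w ∘ₗ TensorProduct.mk k E F x := by
    refine linearMap_ext_groupLikes fun {C} f q => ?_
    have h2 : partialEval (f.hom.toLinearMap ∘ₗ v) q.1 =
        partialEval (f.hom.toLinearMap ∘ₗ w) q.1 := by
      refine linearMap_ext_groupLikes fun {D} g p => ?_
      rw [comp_partialEval, comp_partialEval, ← liftBaseChange_boxMul_eq,
        ← liftBaseChange_boxMul_eq]
      exact h (f ≫ g) p (q.map g.hom)
    exact congrArg (fun φ => φ x) h2
  exact congrArg (fun φ => φ y) h1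

end TensorExt

/-! ### The two functors of monoids attached to a bialgebra -/

section Bialgebra

open Coalgebra Bialgebra

section Elements

variable {B C : Type*} [CommRing B] [Algebra k B] [CommRing C] [Algebra k C]
  {A : Type*} [CommRing A] [Bialgebra k A]

lemma lTensor_comul_eq (g : B ⊗[k] A) : (comul (R := k) (A := A)).lTensor B g =
    Algebra.TensorProduct.map (AlgHom.id k B) (comulAlgHom k A) g := rfl

lemma scalarForm_counit_eq : scalarForm B (counit (R := k) (A := A)) =
    ((Algebra.ofId k B).comp (counitAlgHom k A)).toLinearMap := rfl

lemma lTensor_mul'_boxMul (g h : B ⊗[k] A) :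
    (LinearMap.mul' k A).lTensor B (boxMul g h) = g * h := by
  induction g with
  | zero => simp
  | add x y hx hy => simp only [map_add, LinearMap.add_apply, hx, hy, add_mul]
  | tmul c e =>
    induction h with
    | zero => simp
    | add x y hx hy => simp only [map_add, hx, hy, mul_add]
    | tmul d e' => simp

lemma isGroupLike_one : IsGroupLike (1 : B ⊗[k] A) where
  comul_eq := by simp only [lTensor_comul_eq, boxMul_eq_mul, map_one, mul_one]
  counit_eq := by rw [scalarForm_counit_eq, liftBaseChange_algHom_one]

/-- Comultiplication and counit are algebra morphisms, and the external product is multiplicative in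
both arguments together. -/
lemma IsGroupLike.mul {g h : B ⊗[k] A} (hg : IsGroupLike g) (hh : IsGroupLike h) :
    IsGroupLike (g * h) where
  comul_eq := by
    have h1 := hg.comul_eq
    have h2 := hh.comul_eq
    simp only [lTensor_comul_eq, boxMul_eq_mul] at *
    rw [map_mul, h1, h2, map_mul, map_mul, mul_mul_mul_comm]
  counit_eq := by
    have h1 := hg.counit_eq
    have h2 := hh.counit_eq
    rw [scalarForm_counit_eq] at *
    rw [liftBaseChange_algHom_mul, h1, h2, mul_one]

variable (k B A) in
/-- The monoid of group-like elements of `B ⊗ A`, for a commutative bialgebra `A`. -/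
def groupLikeSubmonoid : Submonoid (B ⊗[k] A) where
  carrier := {g | IsGroupLike g}
  one_mem' := isGroupLike_one
  mul_mem' := IsGroupLike.mul

/-- Extension of scalars for group-like elements, as a morphism of monoids. -/
def groupLikeMap (f : B →ₐ[k] C) : groupLikeSubmonoid k B A →* groupLikeSubmonoid k C A where
  toFun p := ⟨extend A f p.1, IsGroupLike.extend p.2 f⟩
  map_one' := Subtype.ext (map_one (Algebra.TensorProduct.map f (AlgHom.id k A)))
  map_mul' p q := Subtype.ext (map_mul (Algebra.TensorProduct.map f (AlgHom.id k A)) p.1 q.1)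

/-- Composition with a morphism of algebras, as a morphism of convolution monoids. -/
def convComp [IsCocomm k A] (f : B →ₐ[k] C) :
    WithConv (A →ₐ[k] B) →* WithConv (A →ₐ[k] C) where
  toFun a := WithConv.toConv (f.comp a.ofConv)
  map_one' := by
    ext x
    simp
  map_mul' a b := by
    rw [AlgHom.comp_convMul_distrib]

end Elements

variable (A : Type u) [CommRing A] [Bialgebra k A] [IsCocomm k A]

variable (k) in
/-- The affine monoid `C ↦ Hom(A, C)` of a commutative and cocommutative bialgebra `A`. -/
def pointsMonoid : MonoidFunctor k where
  obj C := CommMonCat.of (ULift.{u + 1} (WithConv (A →ₐ[k] C)))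
  map f := CommMonCat.ofHom
    { toFun := fun a => ⟨convComp f.hom a.down⟩
      map_one' := congrArg ULift.up (map_one (convComp f.hom))
      map_mul' := fun a b => congrArg ULift.up (map_mul (convComp f.hom) a.down b.down) }

variable (k) in
/-- The functor of monoids of group-like elements of a bialgebra. -/
def groupLikeMonoid : MonoidFunctor k where
  obj C := CommMonCat.of (ULift.{u + 1} (groupLikeSubmonoid k C A))
  map f := CommMonCat.ofHom
    { toFun := fun p => ⟨groupLikeMap f.hom p.down⟩
      map_one' := congrArg ULift.up (map_one (groupLikeMap f.hom))
      map_mul' := fun p q => congrArg ULift.up (map_mul (groupLikeMap f.hom) p.down q.down) }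
  map_id _ := CommMonCat.hom_ext <| MonoidHom.ext fun x =>
    ULift.ext _ _ (Subtype.ext (extend_id (ULift.down x).1))
  map_comp f g := CommMonCat.hom_ext <| MonoidHom.ext fun x =>
    ULift.ext _ _ (Subtype.ext (extend_comp f.hom g.hom (ULift.down x).1))

/-- The character of `groupLikeMonoid` attached to a point of `A`. -/
def evalCharacter {B : CommAlgCat.{u} k} (a : A →ₐ[k] B) :
    Character (groupLikeMonoid k A) B where
  app {C} f :=
    { toFun := fun p : ULift.{u + 1} (groupLikeSubmonoid k C A) =>
        (f.hom.comp a).toLinearMap.liftBaseChange C p.down.1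
      map_one' := liftBaseChange_algHom_one _
      map_mul' := fun _ _ => liftBaseChange_algHom_mul _ _ _ }
  naturality f g _ := liftBaseChange_extend g.hom (f.hom.comp a).toLinearMap _

variable (k) in
/-- The evaluation pairing between the two functors of monoids of a bialgebra. -/
def evalPairing : pointsMonoid k A ⟶ dual (groupLikeMonoid k A) where
  app B := CommMonCat.ofHom
    { toFun := fun a : ULift.{u + 1} (WithConv (A →ₐ[k] B)) => evalCharacter A a.down.ofConv
      map_one' := Character.ext_app fun {C} f => MonoidHom.ext fun p => by
        refine Eq.trans ?_ (p.down.2.counit_eq)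
        change LinearMap.liftBaseChange C _ _ = LinearMap.liftBaseChange C _ _
        congr 2
        ext x
        simp
      map_mul' := fun a b => Character.ext_app fun {C} f => MonoidHom.ext fun p => by
        refine Eq.trans ?_ (p.down.2.liftBaseChange_conv (f.hom.comp a.down.ofConv).toLinearMap
          (f.hom.comp b.down.ofConv).toLinearMap)
        change LinearMap.liftBaseChange C _ _ = LinearMap.liftBaseChange C _ _
        congr 2
        exact comp_conv f.hom a.down.ofConv.toLinearMap b.down.ofConv.toLinearMap }
  naturality B B' h := by
    ext a
    refine Character.ext_app fun {C} f => MonoidHom.ext fun p => ?_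
    rfl

lemma transpose_evalPairing_apply {B C : CommAlgCat.{u} k} (f : B ⟶ C)
    (p : (groupLikeMonoid k A).obj B) (a : (pointsMonoid k A).obj C) :
    Character.app (((transpose (evalPairing k A)).app B).hom p) f a =
      (ULift.down a).ofConv.toLinearMap.liftBaseChange C (extend A f.hom (ULift.down p).1) := rfl

lemma isIso_of_bijective {G H : MonoidFunctor k} (α : G ⟶ H)
    (h : ∀ B, Function.Bijective (α.app B).hom) : IsIso α := by
  rw [NatTrans.isIso_iff_isIso_app]
  intro B
  rw [ConcreteCategory.isIso_iff_bijective]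
  exact h B

lemma exists_linearMap_of_character [Module.Projective k A] {B : CommAlgCat.{u} k}
    (χ : Character (groupLikeMonoid k A) B) :
    ∃ w : A →ₗ[k] B, ∀ {C : CommAlgCat.{u} k} (f : B ⟶ C) (p : (groupLikeMonoid k A).obj C),
      χ.app f p = (f.hom.toLinearMap ∘ₗ w).liftBaseChange C (ULift.down p).1 := by
  -- Scalar-valued functions are the case `N = k`, through `C ⊗ k = C`.
  obtain ⟨w, hw⟩ := exists_linearMap_of_natural (k := k) (E := A) (N := k) (B := B)
    (fun {C} f p => (χ.app f ⟨p⟩) ⊗ₜ[k] 1) (fun {C D} f g p => by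
      rw [LinearMap.rTensor_tmul]
      exact congrArg (· ⊗ₜ[k] (1 : k)) (χ.naturality f g ⟨p⟩))
  refine ⟨(TensorProduct.rid k B).toLinearMap ∘ₗ w, fun {C} f p => ?_⟩
  have h1 := congrArg (TensorProduct.rid k C) (hw f (ULift.down p))
  rw [TensorProduct.rid_tmul, one_smul] at h1
  refine h1.trans ?_
  generalize (ULift.down p).1 = g
  have key : ∀ z : B ⊗[k] k, TensorProduct.rid k C (extend k f.hom z) =
      f.hom (TensorProduct.rid k B z) := by
    intro z
    induction z with
    | zero => simp
    | add x y hx hy => simp only [map_add, hx, hy]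
    | tmul b a => simp
  have key' : ∀ (c : C) (z : C ⊗[k] k), TensorProduct.rid k C (c • z) =
      c * TensorProduct.rid k C z := by
    intro c z
    induction z with
    | zero => simp
    | add x y hx hy => simp only [map_add, hx, hy, smul_add, mul_add]
    | tmul b a => simp [TensorProduct.smul_tmul']
  induction g with
  | zero => simp
  | add x y hx hy => simp only [map_add, hx, hy]
  | tmul c x =>
    simp only [LinearMap.liftBaseChange_tmul, LinearMap.comp_apply, key, key', smul_eq_mul]
    rfl

/-- Injectivity is density. For surjectivity, a character extends to a linear form `w`, and its
multiplicativity on group-like elements becomes multiplicativity of `w`, again by density in two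
variables. -/
lemma bijective_evalPairing [Module.Projective k A] (B : CommAlgCat.{u} k) :
    Function.Bijective ((evalPairing k A).app B).hom := by
  constructor
  · intro a b h
    refine ULift.ext _ _ (WithConv.ext (AlgHom.toLinearMap_injective ?_))
    refine linearMap_ext_groupLikes fun {C} f p => ?_
    exact congrArg (fun χ : Character (groupLikeMonoid k A) B => χ.app f ⟨p⟩) h
  · intro χ
    obtain ⟨w, hw⟩ := exists_linearMap_of_character A χ
    have h1 : w 1 = 1 := by
      have h := hw (𝟙 B) 1
      rw [map_one] at h
      change 1 = (LinearMap.liftBaseChange B _) ((1 : B) ⊗ₜ[k] (1 : A)) at h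
      simpa using h.symm
    have hmul : w ∘ₗ LinearMap.mul' k A = LinearMap.mul' k B ∘ₗ TensorProduct.map w w := by
      refine linearMap_ext_boxMul fun {C} f p q => ?_
      let P : (groupLikeMonoid k A).obj C := ⟨p⟩
      let Q : (groupLikeMonoid k A).obj C := ⟨q⟩
      have h : χ.app f P * χ.app f Q = _ := (map_mul (χ.app f) P Q).symm.trans (hw f (P * Q))
      rw [hw f P, hw f Q] at h
      have h2 : f.hom.toLinearMap ∘ₗ LinearMap.mul' k B ∘ₗ TensorProduct.map w w =
          LinearMap.mul' k C ∘ₗ TensorProduct.map (f.hom.toLinearMap ∘ₗ w)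
            (f.hom.toLinearMap ∘ₗ w) := by
        ext; simp
      rw [h2, liftBaseChange_boxMul]
      refine Eq.trans ?_ h.symm
      change _ = LinearMap.liftBaseChange C _ (p.1 * q.1)
      rw [← LinearMap.comp_assoc, ← liftBaseChange_lTensor, lTensor_mul'_boxMul]
    refine ⟨⟨WithConv.toConv (AlgHom.ofLinearMap w h1 fun x y =>
      congrArg (fun φ => φ (x ⊗ₜ[k] y)) hmul)⟩, ?_⟩
    exact Character.ext_app fun {C} f => MonoidHom.ext fun p => (hw f p).symm

/-- The generic point of `A` over `B ⊗ A`. -/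
def genericPoint (B : CommAlgCat.{u} k) :
    (pointsMonoid k A).obj (CommAlgCat.of k (B ⊗[k] A)) :=
  ⟨WithConv.toConv Algebra.TensorProduct.includeRight⟩

variable {A} in
/-- The character of `pointsMonoid` over `B`, evaluated at the generic point. -/
def characterElement {B : CommAlgCat.{u} k} (χ : Character (pointsMonoid k A) B) : B ⊗[k] A :=
  χ.app (C := CommAlgCat.of k (B ⊗[k] A)) (CommAlgCat.ofHom Algebra.TensorProduct.includeLeft)
    (genericPoint A B)

/-- Yoneda: every point over `C` is the specialisation of the generic point along `B ⊗ A → C`. -/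
lemma character_apply {B C : CommAlgCat.{u} k} (χ : Character (pointsMonoid k A) B) (f : B ⟶ C)
    (a : (pointsMonoid k A).obj C) :
    χ.app f a = (ULift.down a).ofConv.toLinearMap.liftBaseChange C
      (extend A f.hom (characterElement χ)) := by
  rw [liftBaseChange_algHom_extend]
  let l : CommAlgCat.of k (B ⊗[k] A) ⟶ C := CommAlgCat.ofHom
    (Algebra.TensorProduct.lift f.hom (ULift.down a).ofConv (fun _ _ => .all _ _))
  have h := χ.naturality (CommAlgCat.ofHom Algebra.TensorProduct.includeLeft) l (genericPoint A B)
  have h1 : CommAlgCat.ofHom Algebra.TensorProduct.includeLeft ≫ l = f := by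
    ext b; simp [l]
  have h2 : ((pointsMonoid k A).map l).hom (genericPoint A B) = a := by
    refine ULift.ext _ _ (WithConv.ext (AlgHom.ext fun x => ?_))
    change l.hom (1 ⊗ₜ x) = _
    simp [l]
  rw [h1, h2] at h
  exact h

/-- Over `B ⊗ (A ⊗ A)` the point given by `comul` is the product of the two coordinate points, and a
character turns this into the group-like equation. The unit point gives the counit equation. -/
lemma isGroupLike_characterElement {B : CommAlgCat.{u} k} (χ : Character (pointsMonoid k A) B) :
    IsGroupLike (characterElement χ) where
  comul_eq := by
    let R : CommAlgCat.{u} k := CommAlgCat.of k (B ⊗[k] (A ⊗[k] A))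
    let f : B ⟶ R := CommAlgCat.ofHom Algebra.TensorProduct.includeLeft
    let i (a : A →ₐ[k] A ⊗[k] A) : (pointsMonoid k A).obj R :=
      ⟨WithConv.toConv (Algebra.TensorProduct.includeRight.comp a)⟩
    have hi : ∀ a : A →ₐ[k] A ⊗[k] A, χ.app f (i a) =
        Algebra.TensorProduct.map (AlgHom.id k B) a (characterElement χ) := by
      intro a
      rw [character_apply, liftBaseChange_algHom_extend]
      congr 1
      refine Algebra.TensorProduct.ext' fun b x => ?_
      change b ⊗ₜ[k] (1 : A ⊗[k] A) * (1 : B) ⊗ₜ[k] a x = b ⊗ₜ[k] a x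
      simp
    have hmul : i (comulAlgHom k A) = i Algebra.TensorProduct.includeLeft *
        i Algebra.TensorProduct.includeRight := by
      refine ULift.ext _ _ (WithConv.ext ?_)
      refine Eq.trans ?_ (AlgHom.comp_convMul_distrib
        (Algebra.TensorProduct.includeRight : A ⊗[k] A →ₐ[k] B ⊗[k] (A ⊗[k] A))
        (WithConv.toConv Algebra.TensorProduct.includeLeft)
        (WithConv.toConv Algebra.TensorProduct.includeRight))
      change Algebra.TensorProduct.includeRight.comp (comulAlgHom k A) = _
      have : (WithConv.toConv Algebra.TensorProduct.includeLeft *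
          WithConv.toConv Algebra.TensorProduct.includeRight :
            WithConv (A →ₐ[k] A ⊗[k] A)).ofConv = comulAlgHom k A := by
        refine AlgHom.ext fun x => ?_
        rw [AlgHom.convMul_apply]
        have : Algebra.TensorProduct.lift (Algebra.TensorProduct.includeLeft : A →ₐ[k] A ⊗[k] A)
            Algebra.TensorProduct.includeRight (fun _ _ => .all _ _) = AlgHom.id k _ := by
          ext <;> simp
        exact congrArg (fun φ => φ (comul (R := k) x)) this
      rw [this]
    rw [lTensor_comul_eq, boxMul_eq_mul, ← hi, ← hi, ← hi, hmul, map_mul]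
  counit_eq := by
    have h := character_apply A χ (𝟙 B) 1
    rw [map_one, CommAlgCat.hom_id, extend_id] at h
    exact h.symm

/-- A group-like element is recovered from its character at the generic point; conversely the value
there of a character is group-like and determines it. -/
lemma bijective_transpose_evalPairing (B : CommAlgCat.{u} k) :
    Function.Bijective ((transpose (evalPairing k A)).app B).hom := by
  constructor
  · have key : ∀ p : (groupLikeMonoid k A).obj B,
        characterElement (((transpose (evalPairing k A)).app B).hom p) = (ULift.down p).1 := by
      intro p
      refine (transpose_evalPairing_apply A (CommAlgCat.ofHom
        (Algebra.TensorProduct.includeLeft : B →ₐ[k] B ⊗[k] A)) p (genericPoint A B)).trans ?_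
      refine (liftBaseChange_algHom_extend (Algebra.TensorProduct.includeRight : A →ₐ[k] B ⊗[k] A)
        Algebra.TensorProduct.includeLeft _).trans ?_
      have : Algebra.TensorProduct.lift (Algebra.TensorProduct.includeLeft : B →ₐ[k] B ⊗[k] A)
          (Algebra.TensorProduct.includeRight : A →ₐ[k] B ⊗[k] A) (fun _ _ => .all _ _) =
            AlgHom.id k _ := by
        ext <;> simp
      exact congrArg (fun φ => φ (ULift.down p).1) this
    intro p q h
    refine ULift.ext _ _ (Subtype.ext ?_)
    rw [← key, ← key, h]
  · intro χ
    refine ⟨⟨⟨characterElement χ, isGroupLike_characterElement A χ⟩⟩, ?_⟩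
    exact Character.ext_app fun {C} f => MonoidHom.ext fun a => (character_apply A χ f a).symm

variable (k) in
instance [Module.Projective k A] : IsIso (evalPairing k A) :=
  isIso_of_bijective _ (bijective_evalPairing A)

variable (k) in
instance : IsIso (transpose (evalPairing k A)) :=
  isIso_of_bijective _ (bijective_transpose_evalPairing A)

end Bialgebra

/-! ### The bialgebra of an affine monoid -/

section AffineMonoid

open Coalgebra Bialgebra Algebra.TensorProduct

/-- An identification of the functor of sets underlying `G` with the functor of points of `A`. -/
structure AffineChart (G : MonoidFunctor k) (A : Type u) [CommRing A] [Algebra k A] where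
  equiv : ∀ C : CommAlgCat.{u} k, G.obj C ≃ (A →ₐ[k] C)
  naturality : ∀ {C D : CommAlgCat.{u} k} (f : C ⟶ D) (x : G.obj C),
    equiv D ((G.map f).hom x) = f.hom.comp (equiv C x)

lemma IsSpec.nonempty_affineChart {G : MonoidFunctor k} {A : CommAlgCat.{u} k} (h : IsSpec G A) :
    Nonempty (AffineChart G A) := by
  obtain ⟨e⟩ := h
  refine ⟨⟨fun C => (e.app C).toEquiv.trans (Equiv.ulift.trans
    ⟨fun f => f.hom, fun f => CommAlgCat.ofHom f, fun _ => rfl, fun _ => rfl⟩), ?_⟩⟩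
  intro C D f x
  have := congrArg (fun t => t x) (e.hom.naturality f)
  exact congrArg (fun t => (ULift.down t).hom) this

namespace AffineChart

variable {G : MonoidFunctor k} {A : Type u} [CommRing A] [Algebra k A] (ε : AffineChart G A)
  {C D : Type u} [CommRing C] [Algebra k C] [CommRing D] [Algebra k D]

/-- The product of two points. -/
def mul (a b : A →ₐ[k] C) : A →ₐ[k] C :=
  ε.equiv (.of k C) ((ε.equiv (.of k C)).symm a * (ε.equiv (.of k C)).symm b)

/-- The unit point. -/
def one (C : Type u) [CommRing C] [Algebra k C] : A →ₐ[k] C := ε.equiv (.of k C) 1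

lemma symm_naturality (f : C →ₐ[k] D) (a : A →ₐ[k] C) :
    (ε.equiv (.of k D)).symm (f.comp a) =
      (G.map (CommAlgCat.ofHom f)).hom ((ε.equiv (.of k C)).symm a) := by
  rw [Equiv.symm_apply_eq, ε.naturality, Equiv.apply_symm_apply]
  rfl

lemma comp_mul (f : C →ₐ[k] D) (a b : A →ₐ[k] C) :
    f.comp (ε.mul a b) = ε.mul (f.comp a) (f.comp b) := by
  rw [mul, mul, symm_naturality, symm_naturality, ← map_mul (G.map (CommAlgCat.ofHom f)).hom,
    ε.naturality]
  rfl

lemma comp_one (f : C →ₐ[k] D) : f.comp (ε.one C) = ε.one D := by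
  rw [one, one, ← map_one (G.map (CommAlgCat.ofHom f)).hom, ε.naturality]
  rfl

lemma mul_assoc' (a b c : A →ₐ[k] C) : ε.mul (ε.mul a b) c = ε.mul a (ε.mul b c) := by
  simp only [mul, Equiv.symm_apply_apply, mul_assoc]

lemma mul_comm' (a b : A →ₐ[k] C) : ε.mul a b = ε.mul b a := by
  simp only [mul, mul_comm]

lemma one_mul' (a : A →ₐ[k] C) : ε.mul (ε.one C) a = a := by
  simp only [mul, one, Equiv.symm_apply_apply, one_mul, Equiv.apply_symm_apply]

/-- The comultiplication of the algebra of an affine monoid. -/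
def comul : A →ₐ[k] A ⊗[k] A := ε.mul includeLeft includeRight

lemma comp_comul (f : A ⊗[k] A →ₐ[k] C) :
    f.comp ε.comul = ε.mul (f.comp includeLeft) (f.comp includeRight) := ε.comp_mul f _ _

lemma lift_comp_comul (a b : A →ₐ[k] C) :
    (Algebra.TensorProduct.lift a b (fun _ _ => .all _ _)).comp ε.comul = ε.mul a b := by
  rw [comp_comul]
  congr 1 <;> ext <;> simp

lemma map_comp_comul {A' A'' : Type u} [CommRing A'] [Algebra k A'] [CommRing A''] [Algebra k A'']
    (a : A →ₐ[k] A') (b : A →ₐ[k] A'') :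
    (Algebra.TensorProduct.map a b).comp ε.comul =
      ε.mul (includeLeft.comp a) (includeRight.comp b) := by
  rw [comp_comul]
  congr 1 <;> ext <;> simp

/-- The bialgebra structure on the algebra of an affine monoid. -/
abbrev bialgebra : Bialgebra k A :=
  Bialgebra.ofAlgHom ε.comul (ε.one k)
    -- Both sides of each bialgebra axiom are algebra morphisms out of `A`, that is, points of `G`;
    -- the axiom is the monoid law for the universal points.
    (by
      rw [map_comp_comul, map_comp_comul, comp_mul, AlgHom.comp_id, AlgHom.comp_id,
        ← AlgHom.comp_assoc, comp_comul, comp_comul, mul_assoc']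
      congr 1)
    (by
      rw [map_comp_comul, comp_one, one_mul']
      ext; simp)
    (by
      rw [map_comp_comul, comp_one, mul_comm', one_mul']
      ext; simp)

lemma isCocomm : letI := ε.bialgebra; IsCocomm k A := by
  let _ := ε.bialgebra
  refine ⟨?_⟩
  have : (Algebra.TensorProduct.comm k A A).toAlgHom.comp ε.comul = ε.comul := by
    rw [comp_comul, mul_comm', comul]
    congr 1
  exact congrArg AlgHom.toLinearMap this

/-- An affine monoid is the monoid of points of its bialgebra. -/
lemma nonempty_iso : letI := ε.bialgebra; haveI := ε.isCocomm;
    Nonempty (G ≅ pointsMonoid k A) := by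
  let _ := ε.bialgebra
  have := ε.isCocomm
  have hmul : ∀ (C : CommAlgCat.{u} k) (a b : A →ₐ[k] C),
      (WithConv.toConv a * WithConv.toConv b).ofConv = ε.mul (C := C) a b := by
    intro C a b
    rw [← lift_comp_comul]
    ext x
    rw [AlgHom.convMul_apply]
    rfl
  let τ : G ⟶ pointsMonoid k A :=
    { app := fun C => CommMonCat.ofHom
        { toFun := fun x => ⟨WithConv.toConv (ε.equiv C x)⟩
          map_one' := ULift.ext _ _ (WithConv.ext (by
            change ε.equiv C 1 = (Algebra.ofId k C).comp (ε.one k)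
            rw [comp_one]; rfl))
          map_mul' := fun x y => ULift.ext _ _ (WithConv.ext (by
            refine Eq.trans ?_ (hmul C (ε.equiv C x) (ε.equiv C y)).symm
            exact congrArg (ε.equiv C) (congrArg₂ (· * ·)
              ((ε.equiv C).symm_apply_apply x).symm ((ε.equiv C).symm_apply_apply y).symm))) }
      naturality := fun C D f => CommMonCat.hom_ext <| MonoidHom.ext fun x =>
        ULift.ext _ _ (WithConv.ext (ε.naturality f x)) }
  have : IsIso τ := isIso_of_bijective _ fun C =>
    ⟨fun x y h => (ε.equiv C).injective (congrArg (fun t => (ULift.down t).ofConv) h),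
      fun a => ⟨(ε.equiv C).symm (ULift.down a).ofConv,
        ULift.ext _ _ (WithConv.ext ((ε.equiv C).apply_symm_apply _))⟩⟩
  exact ⟨asIso τ⟩

end AffineChart

end AffineMonoid

/-! ### Square-zero extensions -/

section SquareZero

/-- The algebra of dual numbers over `C`. -/
def DualNum (C : Type u) [CommRing C] : Type u := TrivSqZeroExt C C

namespace DualNum

variable (C : Type u) [CommRing C] [Algebra k C]

instance : CommRing (DualNum C) := inferInstanceAs (CommRing (TrivSqZeroExt C C))

instance : Algebra k (DualNum C) := inferInstanceAs (Algebra k (TrivSqZeroExt C C))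

variable (k) in
/-- The inclusion of constants. -/
def inl : C →ₐ[k] DualNum C := TrivSqZeroExt.inlAlgHom k C C

/-- The element of square zero. -/
def eps : DualNum C := TrivSqZeroExt.inr (1 : C)

variable (k) in
/-- The coefficient of the element of square zero. -/
def snd : DualNum C →ₗ[k] C := (TrivSqZeroExt.sndHom C C).restrictScalars k

variable {C}

lemma snd_mul_inl (x : DualNum C) (c : C) : snd k C (x * inl k C c) = snd k C x * c := by
  refine (TrivSqZeroExt.snd_mul (R := C) (M := C) x (TrivSqZeroExt.inl c)).trans ?_
  rw [TrivSqZeroExt.snd_inl, TrivSqZeroExt.fst_inl, smul_zero, zero_add]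
  rfl

lemma snd_eps_mul_inl (c : C) : snd k C (eps C * inl k C c) = c :=
  (snd_mul_inl _ _).trans (one_mul c)

lemma snd_inl_mul (x : DualNum C) (c : C) : snd k C (inl k C c * x) = c * snd k C x := by
  rw [mul_comm, snd_mul_inl, mul_comm]

lemma eps_mul_eps : eps C * eps C = 0 := TrivSqZeroExt.inr_mul_inr _ _ _

lemma snd_algebraMap (r : k) : snd k C (algebraMap k (DualNum C) r) = 0 := by
  rw [← (inl k C).commutes r]
  rfl

end DualNum

-- On `K = k ⊕ E` with `E` of square zero, a linear map `w` becomes the algebra morphism `e ↦ ε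
-- w(e)` into dual numbers. Naturality in algebras can thus be exploited along arbitrary linear
-- maps.
variable (k) in
lemma exists_squareZero (E : Type u) [AddCommGroup E] [Module k E] :
    ∃ (K : CommAlgCat.{u} k) (u : E →ₗ[k] K) (s : K →ₗ[k] E), s ∘ₗ u = LinearMap.id ∧
      ∀ (C : Type u) [CommRing C] [Algebra k C] (w : E →ₗ[k] C),
        ∃ f : K →ₐ[k] DualNum C, (∀ e, f (u e) = DualNum.eps C * DualNum.inl k C (w e)) ∧
          ∀ x, DualNum.snd k C (f x) = w (s x) := by
  -- `TrivSqZeroExt` requires a right action, here the left one since `k` is commutative.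
  let _ : Module kᵐᵒᵖ E := Module.compHom _ ((RingHom.id k).fromOpposite mul_comm)
  have : IsCentralScalar k E := ⟨fun _ _ => rfl⟩
  refine ⟨CommAlgCat.of k (TrivSqZeroExt k E), TrivSqZeroExt.inrHom k E, TrivSqZeroExt.sndHom k E,
    rfl, fun C _ _ w => ?_⟩
  let v : E →ₗ[k] DualNum C :=
    LinearMap.mulLeft k (DualNum.eps C) ∘ₗ (DualNum.inl k C).toLinearMap ∘ₗ w
  have hv : ∀ x y, v x * v y = 0 := fun x y =>
    (mul_mul_mul_comm _ _ _ _).trans (by rw [DualNum.eps_mul_eps, zero_mul])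
  have hr : ∀ e : E, TrivSqZeroExt.liftEquivOfComm ⟨v, hv⟩ (TrivSqZeroExt.inr e) = v e := by
    intro e
    rw [TrivSqZeroExt.liftEquivOfComm_apply]
    exact TrivSqZeroExt.lift_apply_inr _ _ hv _ _ e
  refine ⟨TrivSqZeroExt.liftEquivOfComm ⟨v, hv⟩, hr, fun x => ?_⟩
  induction x using TrivSqZeroExt.ind with
  | inl_add_inr r e =>
    have hl := (TrivSqZeroExt.liftEquivOfComm ⟨v, hv⟩).commutes r
    rw [TrivSqZeroExt.algebraMap_eq_inl] at hl
    rw [map_add, hl, hr, map_add, DualNum.snd_algebraMap, zero_add]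
    refine (DualNum.snd_eps_mul_inl (w e)).trans ?_
    simp

end SquareZero

/-! ### Algebra structures on the dual of a quasi-coherent functor -/

section DualChart

/-- An identification of the functor of modules underlying `𝒜` with `B ↦ Hom(E, B)`. -/
structure DualChart (𝒜 : AlgebraFunctor.{u + 1} k) (E : Type u) [AddCommGroup E] [Module k E] where
  equiv : ∀ B : CommAlgCat.{u} k, 𝒜.obj B ≃ₗ[B] (E →ₗ[k] B)
  naturality : ∀ {B C : CommAlgCat.{u} k} (f : B ⟶ C) (a : 𝒜.obj B),
    equiv C (𝒜.map f a) = f.hom.toLinearMap ∘ₗ equiv B a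

section QuasiCoherent

variable (E : Type u) [AddCommGroup E] [Module k E]

/-- The dual of a quasi-coherent functor is `B ↦ Hom(E, B)`. -/
def dualQuasiCoherentEquiv (B : CommAlgCat.{u} k) :
    (quasiCoherent (k := k) E).DualObj B ≃ₗ[B] (E →ₗ[k] B) where
  toFun φ := (LinearMap.liftBaseChangeEquiv B).symm (φ.app (𝟙 B))
  map_add' φ ψ := by
    rw [ModuleFunctor.DualObj.add_app]
    exact map_add (LinearMap.liftBaseChangeEquiv B).symm _ _
  map_smul' b φ := by
    rw [ModuleFunctor.DualObj.smul_app]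
    exact map_smul (LinearMap.liftBaseChangeEquiv B).symm _ _
  invFun w := ⟨fun {C} f => (f.hom.toLinearMap ∘ₗ w).liftBaseChange C, fun f g x =>
    liftBaseChange_extend g.hom (f.hom.toLinearMap ∘ₗ w) x⟩
  left_inv φ := by
    refine ModuleFunctor.DualObj.ext_app fun {C} f => ?_
    refine (LinearMap.liftBaseChangeEquiv C).symm.injective (LinearMap.ext fun x => ?_)
    have h := φ.naturality (𝟙 B) f ((1 : B) ⊗ₜ[k] x)
    rw [Category.id_comp] at h
    have h2 : (quasiCoherent (k := k) E).map f ((1 : B) ⊗ₜ[k] x) = (1 : C) ⊗ₜ[k] x :=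
      congrArg (· ⊗ₜ[k] x) (map_one f.hom)
    rw [h2] at h
    refine Eq.trans ?_ h.symm
    exact one_smul C _
  right_inv w := LinearMap.ext fun x => one_smul B (w x)

lemma dualQuasiCoherentEquiv_naturality {B C : CommAlgCat.{u} k} (f : B ⟶ C)
    (φ : (quasiCoherent (k := k) E).DualObj B) :
    dualQuasiCoherentEquiv E C ((quasiCoherent (k := k) E).dual.map f φ) =
      f.hom.toLinearMap ∘ₗ dualQuasiCoherentEquiv E B φ := by
  obtain ⟨w, rfl⟩ := (dualQuasiCoherentEquiv E B).symm.surjective φ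
  rw [LinearEquiv.apply_symm_apply]
  refine LinearMap.ext fun x => ?_
  exact one_smul C _

end QuasiCoherent

variable {𝒜 : AlgebraFunctor.{u + 1} k} {E : Type u} [AddCommGroup E] [Module k E]

/-- A structure of functor of algebras on `𝐄*` defines a chart. -/
def DualChart.ofIso (i : 𝒜.toModuleFunctor.Iso (quasiCoherent (k := k) E).dual) :
    DualChart 𝒜 E where
  equiv B := (i.app B).trans (dualQuasiCoherentEquiv E B)
  naturality f a := by
    have h := i.naturality f a
    exact (congrArg (dualQuasiCoherentEquiv E _) h).trans
      (dualQuasiCoherentEquiv_naturality E f _)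

/-- A chart comes from an isomorphism with `𝐄*`. -/
def DualChart.toIso (θ : DualChart 𝒜 E) :
    𝒜.toModuleFunctor.Iso (quasiCoherent (k := k) E).dual where
  app B := (θ.equiv B).trans (dualQuasiCoherentEquiv E B).symm
  naturality {B C} f a := by
    apply (dualQuasiCoherentEquiv E C).injective
    refine Eq.trans ?_ (dualQuasiCoherentEquiv_naturality E f _).symm
    refine ((dualQuasiCoherentEquiv E C).apply_symm_apply _).trans ?_
    refine (θ.naturality f a).trans ?_
    exact congrArg _ ((dualQuasiCoherentEquiv E B).apply_symm_apply _).symm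

namespace DualChart

variable (θ : DualChart 𝒜 E)

/-- The product of linear maps defined by a chart. -/
def mul {C : Type u} [CommRing C] [Algebra k C] (v w : E →ₗ[k] C) : E →ₗ[k] C :=
  θ.equiv (.of k C) ((θ.equiv (.of k C)).symm v * (θ.equiv (.of k C)).symm w)

/-- The unit linear map defined by a chart. -/
def one (C : Type u) [CommRing C] [Algebra k C] : E →ₗ[k] C := θ.equiv (.of k C) 1

variable {C D : Type u} [CommRing C] [Algebra k C] [CommRing D] [Algebra k D]

lemma symm_naturality {B C : CommAlgCat.{u} k} (f : B ⟶ C) (w : E →ₗ[k] B) :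
    (θ.equiv C).symm (f.hom.toLinearMap ∘ₗ w) = 𝒜.map f ((θ.equiv B).symm w) := by
  rw [LinearEquiv.symm_apply_eq, θ.naturality, LinearEquiv.apply_symm_apply]

lemma comp_mul (f : C →ₐ[k] D) (v w : E →ₗ[k] C) :
    f.toLinearMap ∘ₗ θ.mul v w = θ.mul (f.toLinearMap ∘ₗ v) (f.toLinearMap ∘ₗ w) := by
  have h := θ.symm_naturality (CommAlgCat.ofHom f)
  rw [CommAlgCat.hom_ofHom] at h
  rw [mul, mul, h, h, ← map_mul (𝒜.map (CommAlgCat.ofHom f)), θ.naturality]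
  rfl

lemma comp_one (f : C →ₐ[k] D) : f.toLinearMap ∘ₗ θ.one C = θ.one D := by
  rw [one, one, ← map_one (𝒜.map (CommAlgCat.ofHom f)), θ.naturality]
  rfl

lemma equiv_smul_mul {B : CommAlgCat.{u} k} (c : B) (v w : E →ₗ[k] B) :
    θ.equiv B ((θ.equiv B).symm (c • v) * (θ.equiv B).symm w) =
      c • θ.equiv B ((θ.equiv B).symm v * (θ.equiv B).symm w) := by
  rw [map_smul, smul_mul_assoc, map_smul]

lemma smul_mul (c : C) (v w : E →ₗ[k] C) : θ.mul (c • v) w = c • θ.mul v w :=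
  θ.equiv_smul_mul (B := .of k C) c v w

lemma mul_comm' (v w : E →ₗ[k] C) : θ.mul v w = θ.mul w v := by
  rw [mul, mul, mul_comm]

lemma mul_smul' (c : C) (v w : E →ₗ[k] C) : θ.mul v (c • w) = c • θ.mul v w := by
  rw [mul_comm', smul_mul, mul_comm']

lemma mul_assoc' (v w x : E →ₗ[k] C) : θ.mul (θ.mul v w) x = θ.mul v (θ.mul w x) := by
  simp only [mul, LinearEquiv.symm_apply_apply, mul_assoc]

lemma one_mul' (w : E →ₗ[k] C) : θ.mul (θ.one C) w = w := by
  simp only [mul, one, LinearEquiv.symm_apply_apply, one_mul, LinearEquiv.apply_symm_apply]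

/-- The product defined by a chart is the convolution product of a comultiplication. -/
lemma exists_comul : ∃ Δ : E →ₗ[k] E ⊗[k] E, ∀ {C : Type u} [CommRing C] [Algebra k C]
    (v w : E →ₗ[k] C), θ.mul v w = LinearMap.mul' k C ∘ₗ TensorProduct.map v w ∘ₗ Δ := by
  obtain ⟨K, u, s, -, hK⟩ := exists_squareZero k E
  let u₁ : E →ₗ[k] K ⊗[k] K :=
    (Algebra.TensorProduct.includeLeft : K →ₐ[k] K ⊗[k] K).toLinearMap ∘ₗ u
  let u₂ : E →ₗ[k] K ⊗[k] K :=
    (Algebra.TensorProduct.includeRight : K →ₐ[k] K ⊗[k] K).toLinearMap ∘ₗ u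
  -- The product of the two universal maps `u₁`, `u₂` over `K ⊗ K`, projected to `E ⊗ E`, is the
  -- comultiplication.
  refine ⟨TensorProduct.map s s ∘ₗ θ.mul u₁ u₂, fun {C} _ _ v w => ?_⟩
  obtain ⟨f, hf, hf'⟩ := hK C v
  -- Iterated dual numbers supply independent parameters `η₁` for `v` and `η₂` for `w`. The
  -- specialised product is `η₁ η₂` times the product of `v` and `w`, and its `η₁ η₂`-coefficient is
  -- extracted.
  obtain ⟨g, hg, hg'⟩ := hK (DualNum C) ((DualNum.inl k C).toLinearMap ∘ₗ w)
  let j : C →ₐ[k] DualNum (DualNum C) := (DualNum.inl k (DualNum C)).comp (DualNum.inl k C)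
  let F : K ⊗[k] K →ₐ[k] DualNum (DualNum C) :=
    Algebra.TensorProduct.lift ((DualNum.inl k (DualNum C)).comp f) g (fun _ _ => .all _ _)
  have hF : ∀ x y, F (x ⊗ₜ y) = DualNum.inl k (DualNum C) (f x) * g y := by simp [F]
  let η₁ : DualNum (DualNum C) := DualNum.inl k (DualNum C) (DualNum.eps C)
  let η₂ : DualNum (DualNum C) := DualNum.eps (DualNum C)
  have h1 : F.toLinearMap ∘ₗ u₁ = η₁ • (j.toLinearMap ∘ₗ v) := by
    refine LinearMap.ext fun e => ?_
    change F (u e ⊗ₜ 1) = η₁ * j (v e)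
    rw [hF, map_one, mul_one, hf, map_mul]
    rfl
  have h2 : F.toLinearMap ∘ₗ u₂ = η₂ • (j.toLinearMap ∘ₗ w) := by
    refine LinearMap.ext fun e => ?_
    change F (1 ⊗ₜ u e) = η₂ * j (w e)
    rw [hF, map_one, map_one, one_mul, hg]
    rfl
  have h3 : ∀ z : K ⊗[k] K, DualNum.snd k C (DualNum.snd k (DualNum C) (F z)) =
      LinearMap.mul' k C (TensorProduct.map v w (TensorProduct.map s s z)) := by
    intro z
    induction z with
    | zero => simp only [map_zero]
    | add x y hx hy => simp only [map_add, hx, hy]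
    | tmul x y =>
      rw [hF, DualNum.snd_inl_mul, hg', LinearMap.comp_apply, AlgHom.toLinearMap_apply,
        DualNum.snd_mul_inl, hf']
      simp
  refine LinearMap.ext fun e => ?_
  have h4 := θ.comp_mul F u₁ u₂
  rw [h1, h2, smul_mul, mul_smul', ← comp_mul] at h4
  have h5 : F (θ.mul u₁ u₂ e) = η₁ * (η₂ * j (θ.mul v w e)) := congrArg (fun φ => φ e) h4
  refine Eq.trans ?_ (h3 _)
  rw [h5]
  simp only [η₁, η₂, j, AlgHom.comp_apply]
  rw [DualNum.snd_inl_mul, DualNum.snd_eps_mul_inl, DualNum.snd_eps_mul_inl]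

/-- The comultiplication defined by a chart. -/
def comul : E →ₗ[k] E ⊗[k] E := θ.exists_comul.choose

lemma mul_eq (v w : E →ₗ[k] C) :
    θ.mul v w = LinearMap.mul' k C ∘ₗ TensorProduct.map v w ∘ₗ θ.comul :=
  θ.exists_comul.choose_spec v w

lemma one_eq : θ.one C = scalarForm C (θ.one k) := (θ.comp_one (Algebra.ofId k C)).symm

end DualChart

/-- A dual basis for the difference writes it with coefficients that all vanish. -/
lemma eq_of_forall_functional [Module.Projective k E] {x y : E} (h : ∀ w : E →ₗ[k] k, w x = w y) :
    x = y := by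
  obtain ⟨T, φ, hT⟩ := exists_dualBasis (k := k) {x - y}
  have := hT (x - y) (by simp)
  rw [← sub_eq_zero, this]
  exact Finset.sum_eq_zero fun l _ => by rw [map_sub, h, sub_self, zero_smul]

lemma eq_of_forall_map [Module.Projective k E] {z z' : E ⊗[k] E}
    (h : ∀ v w : E →ₗ[k] k, LinearMap.mul' k k (TensorProduct.map v w z) =
      LinearMap.mul' k k (TensorProduct.map v w z')) : z = z' := by
  refine eq_of_lTensor fun w => (TensorProduct.rid k E).injective
    (eq_of_forall_functional (k := k) fun v => ?_)
  have key : v ∘ₗ (TensorProduct.rid k E).toLinearMap ∘ₗ w.lTensor E =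
      LinearMap.mul' k k ∘ₗ TensorProduct.map v w := by
    ext; simp [mul_comm]
  exact (congrArg (fun φ => φ z) key).trans ((h v w).trans (congrArg (fun φ => φ z') key).symm)

lemma eq_of_forall_map_map [Module.Projective k E] {z z' : E ⊗[k] (E ⊗[k] E)}
    (h : ∀ v w x : E →ₗ[k] k,
      LinearMap.mul' k k (TensorProduct.map v (LinearMap.mul' k k ∘ₗ TensorProduct.map w x) z) =
      LinearMap.mul' k k (TensorProduct.map v (LinearMap.mul' k k ∘ₗ TensorProduct.map w x) z')) :
    z = z' := by
  refine eq_of_lTensor_map fun w x => (TensorProduct.rid k E).injective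
    (eq_of_forall_functional (k := k) fun v => ?_)
  have key : v ∘ₗ (TensorProduct.rid k E).toLinearMap ∘ₗ
      (LinearMap.mul' k k ∘ₗ TensorProduct.map w x).lTensor E =
      LinearMap.mul' k k ∘ₗ
        TensorProduct.map v (LinearMap.mul' k k ∘ₗ TensorProduct.map w x) := by
    ext; simp [mul_comm]
  exact (congrArg (fun φ => φ z) key).trans ((h v w x).trans (congrArg (fun φ => φ z') key).symm)

namespace DualChart

variable (θ : DualChart 𝒜 E) [Module.Projective k E]

/-- The coalgebra structure defined by a chart. -/
abbrev coalgebra : Coalgebra k E where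
  comul := θ.comul
  counit := θ.one k
  coassoc := by
    -- Triples of functionals separate `E ⊗ (E ⊗ E)`, so coassociativity is associativity of the
    -- product tested on forms over `k`. The counit axioms come from the unit in the same way.
    refine LinearMap.ext fun e => eq_of_forall_map_map fun v w x => ?_
    have h := congrArg (fun φ => φ e) (θ.mul_assoc' v w x)
    simp only [mul_eq] at h
    refine Eq.trans ?_ (h.trans ?_)
    · simp only [LinearMap.comp_apply]
      generalize θ.comul e = z
      have key : LinearMap.mul' k k ∘ₗ TensorProduct.map v (LinearMap.mul' k k ∘ₗ
          TensorProduct.map w x) ∘ₗ (TensorProduct.assoc k E E E).toLinearMap =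
          LinearMap.mul' k k ∘ₗ TensorProduct.map (LinearMap.mul' k k ∘ₗ
          TensorProduct.map v w) x := by
        ext; simp [mul_assoc]
      refine (congrArg (fun φ => φ (θ.comul.rTensor E z)) key).trans ?_
      simp only [LinearMap.comp_apply]
      rw [LinearMap.rTensor, ← LinearMap.comp_apply (TensorProduct.map _ _), ← TensorProduct.map_comp]
      rfl
    · simp only [LinearMap.comp_apply]
      generalize θ.comul e = z
      rw [LinearMap.lTensor, ← LinearMap.comp_apply (TensorProduct.map _ _) (TensorProduct.map _ _),
        ← TensorProduct.map_comp]
      rfl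
  rTensor_counit_comp_comul := by
    refine LinearMap.ext fun e => eq_of_lTensor fun w => (TensorProduct.lid k k).injective ?_
    have h := congrArg (fun φ => φ e) (θ.one_mul' w)
    simp only [mul_eq] at h
    refine Eq.trans ?_ (h.trans ?_)
    · simp only [LinearMap.comp_apply]
      generalize θ.comul e = z
      induction z with
      | zero => simp
      | add x y hx hy => simp only [map_add, hx, hy]
      | tmul x y => simp
    · simp
  lTensor_counit_comp_comul := by
    refine LinearMap.ext fun e => (TensorProduct.rid k E).injective
      (eq_of_forall_functional (k := k) fun w => ?_)
    have h := congrArg (fun φ => φ e) ((θ.mul_comm' w (θ.one k)).trans (θ.one_mul' w))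
    simp only [mul_eq] at h
    refine Eq.trans ?_ (h.trans ?_)
    · simp only [LinearMap.comp_apply]
      generalize θ.comul e = z
      induction z with
      | zero => simp
      | add x y hx hy => simp only [map_add, hx, hy]
      | tmul x y => simp [mul_comm]
    · simp

lemma isCocomm : letI := θ.coalgebra; Coalgebra.IsCocomm k E := by
  let _ := θ.coalgebra
  refine ⟨LinearMap.ext fun e => eq_of_forall_map fun v w => ?_⟩
  have h := congrArg (fun φ => φ e) (θ.mul_comm' w v)
  simp only [mul_eq] at h
  refine Eq.trans ?_ h
  simp only [LinearMap.comp_apply]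
  change LinearMap.mul' k k (TensorProduct.map v w (TensorProduct.comm k E E (θ.comul e))) = _
  generalize θ.comul e = z
  induction z with
  | zero => simp
  | add x y hx hy => simp only [map_add, hx, hy]
  | tmul x y => simp [mul_comm]

end DualChart

end DualChart

/-! ### The spectrum of the dual of a coalgebra -/

section SpecDual

open Coalgebra

/-! ### Evaluation of `𝐄*` at an element of `B ⊗ E` -/

section Eval

variable {B C D : Type*} [CommRing B] [Algebra k B] [CommRing C] [Algebra k C]
  [CommRing D] [Algebra k D] {E : Type*} [AddCommGroup E] [Module k E]

/-- The value in `C ⊗ B` of a linear map `E → C` at an element of `B ⊗ E`. -/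
def evalAt (w : E →ₗ[k] C) (g : B ⊗[k] E) : C ⊗[k] B :=
  ((Algebra.TensorProduct.includeLeft : C →ₐ[k] C ⊗[k] B).toLinearMap ∘ₗ w).liftBaseChange
    (C ⊗[k] B) (extend E (Algebra.TensorProduct.includeRight : B →ₐ[k] C ⊗[k] B) g)

lemma evalAt_eq (w : E →ₗ[k] C) (g : B ⊗[k] E) :
    evalAt w g = w.rTensor B (TensorProduct.comm k B E g) := by
  rw [evalAt]
  induction g with
  | zero => simp
  | add x y hx hy => simp only [map_add, hx, hy]
  | tmul b e => simp

lemma lid_evalAt (w : E →ₗ[k] k) (g : B ⊗[k] E) :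
    Algebra.TensorProduct.lid k B (evalAt w g) = (scalarForm B w).liftBaseChange B g := by
  rw [evalAt_eq]
  induction g with
  | zero => simp
  | add x y hx hy => simp only [map_add, hx, hy]
  | tmul b e => simp [Algebra.smul_def, mul_comm]

lemma evalAt_comp (f : C →ₐ[k] D) (w : E →ₗ[k] C) (g : B ⊗[k] E) :
    evalAt (f.toLinearMap ∘ₗ w) g =
      Algebra.TensorProduct.map f (AlgHom.id k B) (evalAt w g) := by
  rw [evalAt_eq, evalAt_eq, LinearMap.rTensor_comp_apply]
  rfl

lemma evalAt_extend (h : B →ₐ[k] D) (w : E →ₗ[k] C) (g : B ⊗[k] E) :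
    evalAt w (extend E h g) = Algebra.TensorProduct.map (AlgHom.id C C) h (evalAt w g) := by
  rw [evalAt_eq, evalAt_eq]
  induction g with
  | zero => simp
  | add x y hx hy => simp only [map_add, hx, hy]
  | tmul b e => simp

lemma evalAt_add (v w : E →ₗ[k] C) (g : B ⊗[k] E) :
    evalAt (v + w) g = evalAt v g + evalAt w g := by
  rw [evalAt, LinearMap.comp_add, liftBaseChange_add]
  rfl

lemma evalAt_smul (c : C) (w : E →ₗ[k] C) (g : B ⊗[k] E) :
    evalAt (c • w) g = c • evalAt w g := by
  have h : (Algebra.TensorProduct.includeLeft : C →ₐ[k] C ⊗[k] B).toLinearMap ∘ₗ (c • w) =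
      (c ⊗ₜ[k] (1 : B)) •
        ((Algebra.TensorProduct.includeLeft : C →ₐ[k] C ⊗[k] B).toLinearMap ∘ₗ w) := by
    ext; simp
  rw [evalAt, h, liftBaseChange_smul, Algebra.smul_def c, smul_eq_mul]
  rfl

variable [Coalgebra k E]

/-- Extended to `C ⊗ B`, the element stays group-like, and pairing with it is multiplicative for
convolution. -/
lemma IsGroupLike.evalAt_conv {g : B ⊗[k] E} (hg : IsGroupLike g) (v w : E →ₗ[k] C) :
    evalAt (conv v w) g = evalAt v g * evalAt w g := by
  rw [evalAt, comp_conv, (hg.extend _).liftBaseChange_conv]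
  rfl

lemma IsGroupLike.evalAt_counit {g : B ⊗[k] E} (hg : IsGroupLike g) :
    evalAt (scalarForm C (counit (R := k) (A := E))) g = 1 := by
  rw [evalAt, scalarForm_comp, (hg.extend _).counit_eq]

end Eval

variable {𝒜 : AlgebraFunctor.{u + 1} k} {E : Type u} [AddCommGroup E] [Module k E]

/-- The algebra structure transported by a chart is the convolution product. -/
structure DualChart.IsConv [Coalgebra k E] (θ : DualChart 𝒜 E) : Prop where
  equiv_mul : ∀ {B : CommAlgCat.{u} k} (a b : 𝒜.obj B),
    θ.equiv B (a * b) = conv (θ.equiv B a) (θ.equiv B b)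
  equiv_one : ∀ B : CommAlgCat.{u} k, θ.equiv B 1 = scalarForm B (counit (R := k) (A := E))

lemma DualChart.isConv (θ : DualChart 𝒜 E) [Module.Projective k E] :
    letI := θ.coalgebra; θ.IsConv := by
  let _ := θ.coalgebra
  refine ⟨fun {B} a b => ?_, fun B => θ.one_eq (C := B)⟩
  have h := θ.mul_eq (C := B) (θ.equiv B a) (θ.equiv B b)
  refine Eq.trans ?_ h
  exact congrArg (θ.equiv B) (congrArg₂ (· * ·) ((θ.equiv B).symm_apply_apply a).symm
    ((θ.equiv B).symm_apply_apply b).symm)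

/-- Naturality and linearity of `φ` combined. With `c = ε` it compares the value of `φ` at the
universal map `E → K` with its value at any `a`. -/
lemma DualChart.map_app_eq_smul (θ : DualChart 𝒜 E) {B C D K : CommAlgCat.{u} k} (φ : 𝒜.SpecObj B)
    (F : K ⟶ D) (i : C ⟶ D) (c : D) (v : E →ₗ[k] K) (a : 𝒜.obj C)
    (h : ∀ e, F.hom (v e) = c * i.hom (θ.equiv C a e)) :
    Algebra.TensorProduct.map F.hom (AlgHom.id k B) (φ.app K ((θ.equiv K).symm v)) =
      c • Algebra.TensorProduct.map i.hom (AlgHom.id k B) (φ.app C a) := by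
  have h1 : 𝒜.map F ((θ.equiv K).symm v) = c • 𝒜.map i a := by
    apply (θ.equiv D).injective
    rw [map_smul, θ.naturality, θ.naturality, LinearEquiv.apply_symm_apply]
    exact LinearMap.ext h
  rw [← φ.naturality, h1, map_smul, φ.naturality]

/-- A morphism of functors of modules from `𝐄*` to a quasi-coherent functor is the evaluation at
an element. -/
lemma DualChart.exists_eq_evalAt (θ : DualChart 𝒜 E) {B : CommAlgCat.{u} k} (φ : 𝒜.SpecObj B) :
    ∃ g : B ⊗[k] E, ∀ (C : CommAlgCat.{u} k) (a : 𝒜.obj C),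
      φ.app C a = evalAt (θ.equiv C a) g := by
  obtain ⟨K, u, s, -, hK⟩ := exists_squareZero k E
  -- The value at the universal map, projected to `E`, must be the representing element; the
  -- `ε`-coefficient of `h2` confirms this for every `a`.
  let z : K ⊗[k] B := φ.app K ((θ.equiv K).symm u)
  refine ⟨(TensorProduct.comm k B E).symm (s.rTensor B z), fun C a => ?_⟩
  rw [evalAt_eq, LinearEquiv.apply_symm_apply]
  obtain ⟨f, hf, hf'⟩ := hK C (θ.equiv C a)
  have h2 := θ.map_app_eq_smul φ (D := .of k (DualNum C)) (CommAlgCat.ofHom f)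
    (CommAlgCat.ofHom (DualNum.inl k C)) (DualNum.eps C) u a hf
  have h3 := congrArg ((DualNum.snd k C).rTensor B) h2
  have h4 : ∀ x : C ⊗[k] B, (DualNum.snd k C).rTensor B
      (DualNum.eps C • Algebra.TensorProduct.map (DualNum.inl k C) (AlgHom.id k B) x) = x := by
    intro x
    induction x with
    | zero => simp
    | add x y hx hy => simp only [map_add, smul_add, hx, hy]
    | tmul c b =>
      rw [Algebra.TensorProduct.map_tmul, TensorProduct.smul_tmul']
      exact congrArg (· ⊗ₜ[k] b) (DualNum.snd_eps_mul_inl c)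
  have h5 : ∀ x : K ⊗[k] B, (DualNum.snd k C).rTensor B
      (Algebra.TensorProduct.map f (AlgHom.id k B) x) =
        (θ.equiv C a).rTensor B (s.rTensor B x) := by
    intro x
    induction x with
    | zero => simp
    | add x y hx hy => simp only [map_add, hx, hy]
    | tmul c b =>
      rw [Algebra.TensorProduct.map_tmul]
      exact congrArg (· ⊗ₜ[k] b) (hf' c)
  exact (h4 _).symm.trans (h3.symm.trans (h5 z))

namespace DualChart.IsConv

variable [Coalgebra k E] {θ : DualChart 𝒜 E}

/-- The point of the spectrum attached to a group-like element. -/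
def ofGroupLike (hθ : θ.IsConv) {B : CommAlgCat.{u} k} (p : GroupLikes (k := k) B E) :
    𝒜.SpecObj B where
  app C :=
    { toFun a := evalAt (θ.equiv C a) p.1
      map_one' := by rw [hθ.equiv_one, p.2.evalAt_counit]
      map_mul' a b := by rw [hθ.equiv_mul, p.2.evalAt_conv]
      map_zero' := by rw [map_zero, evalAt_eq, LinearMap.rTensor_zero, LinearMap.zero_apply]
      map_add' a b := by rw [map_add, evalAt_add]
      commutes' c := by
        rw [Algebra.algebraMap_eq_smul_one, map_smul, evalAt_smul, hθ.equiv_one, p.2.evalAt_counit,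
          Algebra.algebraMap_eq_smul_one] }
  naturality f a := by
    change evalAt (θ.equiv _ _) p.1 = _
    rw [θ.naturality, evalAt_comp]
    rfl

lemma map_ofGroupLike (hθ : θ.IsConv) {B B' : CommAlgCat.{u} k} (h : B ⟶ B')
    (p : GroupLikes (k := k) B E) :
    (spec 𝒜).map h (hθ.ofGroupLike p) = hθ.ofGroupLike (p.map h.hom) :=
  AlgebraFunctor.SpecObj.ext_app fun C a => (evalAt_extend h.hom (θ.equiv C a) p.1).symm

variable [Module.Projective k E]

lemma ofGroupLike_injective (hθ : θ.IsConv) {B : CommAlgCat.{u} k} :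
    Function.Injective (hθ.ofGroupLike (B := B)) := by
  intro p q h
  refine Subtype.ext (eq_of_scalarForm fun w => ?_)
  have h1 := congrArg (fun φ : 𝒜.SpecObj B =>
    φ.app (.of k k) ((θ.equiv (.of k k)).symm w)) h
  change evalAt (θ.equiv (.of k k) ((θ.equiv (.of k k)).symm w)) p.1 =
    evalAt (θ.equiv (.of k k) ((θ.equiv (.of k k)).symm w)) q.1 at h1
  rw [LinearEquiv.apply_symm_apply] at h1
  rw [← lid_evalAt, ← lid_evalAt]
  exact congrArg (Algebra.TensorProduct.lid k B) h1

/-- A morphism is evaluation at some `g`; its multiplicativity over the base `k` alone already makes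
`g` group-like. -/
lemma ofGroupLike_surjective (hθ : θ.IsConv) {B : CommAlgCat.{u} k} :
    Function.Surjective (hθ.ofGroupLike (B := B)) := by
  intro φ
  obtain ⟨g, hg⟩ := θ.exists_eq_evalAt φ
  have hw : ∀ w : E →ₗ[k] k, (scalarForm B w).liftBaseChange B g =
      Algebra.TensorProduct.lid k B (φ.app (.of k k) ((θ.equiv (.of k k)).symm w)) := by
    intro w
    rw [hg, LinearEquiv.apply_symm_apply]
    exact (lid_evalAt w g).symm
  have hg' : IsGroupLike g := by
    refine isGroupLike_of_scalarForm ?_ fun v w => ?_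
    · have h : (θ.equiv (.of k k)).symm (counit (R := k) (A := E)) = 1 := by
        rw [LinearEquiv.symm_apply_eq, hθ.equiv_one]
        rfl
      rw [hw, h, map_one]
      exact map_one (Algebra.TensorProduct.lid k B)
    · have h : (θ.equiv (.of k k)).symm (conv v w) =
          (θ.equiv (.of k k)).symm v * (θ.equiv (.of k k)).symm w := by
        rw [LinearEquiv.symm_apply_eq, hθ.equiv_mul, LinearEquiv.apply_symm_apply,
          LinearEquiv.apply_symm_apply]
      rw [hw, hw, hw, h, map_mul]
      exact map_mul (Algebra.TensorProduct.lid k B) _ _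
  exact ⟨⟨g, hg'⟩, AlgebraFunctor.SpecObj.ext_app fun C a => (hg C a).symm⟩

/-- The spectrum of the dual of a coalgebra is the functor of group-like elements. -/
def groupLikesEquiv (hθ : θ.IsConv) (B : CommAlgCat.{u} k) :
    GroupLikes (k := k) B E ≃ 𝒜.SpecObj B :=
  Equiv.ofBijective hθ.ofGroupLike ⟨hθ.ofGroupLike_injective, hθ.ofGroupLike_surjective⟩

lemma groupLikesEquiv_map (hθ : θ.IsConv) {B B' : CommAlgCat.{u} k} (h : B ⟶ B')
    (p : GroupLikes (k := k) B E) :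
    hθ.groupLikesEquiv B' (p.map h.hom) = (spec 𝒜).map h (hθ.groupLikesEquiv B p) :=
  (hθ.map_ofGroupLike h p).symm

end DualChart.IsConv

/-! ### The dual of a coalgebra as a functor of algebras -/

section ConvFunctor

variable (E) [Coalgebra k E] [IsCocomm k E]

/-- Composition with a morphism of algebras, as a morphism of convolution algebras. -/
def ConvAlg.map {B C : Type*} [CommRing B] [Algebra k B] [CommRing C] [Algebra k C]
    (f : B →ₐ[k] C) : ConvAlg k B E →+* ConvAlg k C E where
  toFun w := ConvAlg.of k C E (f.toLinearMap ∘ₗ w.lin)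
  map_one' := congrArg (ConvAlg.of k C E) (scalarForm_comp f counit)
  map_mul' v w := congrArg (ConvAlg.of k C E) (comp_conv f v.lin w.lin)
  map_zero' := congrArg (ConvAlg.of k C E) (LinearMap.comp_zero _)
  map_add' v w := congrArg (ConvAlg.of k C E) (LinearMap.comp_add v.lin w.lin f.toLinearMap)

variable (k) in
/-- The functor of algebras `B ↦ Hom(E, B)`, with the convolution product. -/
def convFunctor : AlgebraFunctor.{u + 1} k where
  obj B := ULift.{u + 1} (ConvAlg k B E)
  commRing _ := inferInstance
  algebra _ := inferInstance
  map f := (ULift.ringEquiv.symm.toRingHom.comp (ConvAlg.map E f.hom)).comp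
    ULift.ringEquiv.toRingHom
  map_algebraMap {B C} f b := by
    refine ULift.ext _ _ ((ConvAlg.of k C E).symm.injective ?_)
    change f.hom.toLinearMap ∘ₗ (algebraMap B (ConvAlg k B E) b).lin =
      (algebraMap C (ConvAlg k C E) (f.hom b)).lin
    rw [ConvAlg.lin_algebraMap, ConvAlg.lin_algebraMap]
    ext x
    simp
  map_id B x := rfl
  map_comp f g x := rfl

variable (k) in
/-- The tautological chart of the functor `B ↦ Hom(E, B)`. -/
def convChart : DualChart (convFunctor k E) E where
  equiv B := ULift.moduleEquiv.trans (ConvAlg.of k B E).symm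
  naturality _ _ := rfl

lemma isConv_convChart : (convChart k E).IsConv := ⟨fun _ _ => rfl, fun _ => rfl⟩

lemma isSpecDual_of_equiv [Module.Projective k E] {H : MonoidFunctor k}
    (e : ∀ B, H.obj B ≃ GroupLikes (k := k) B E)
    (he : ∀ {B C : CommAlgCat.{u} k} (f : B ⟶ C) (x : H.obj B),
      e C ((H.map f).hom x) = (e B x).map f.hom) : IsSpecDual H E :=
  ⟨convFunctor k E, ⟨(convChart k E).toIso⟩,
    ⟨NatIso.ofComponents
      (fun B => ((e B).trans ((isConv_convChart E).groupLikesEquiv B)).toIso) fun {B C} f => by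
        ext x
        refine (congrArg ((isConv_convChart E).groupLikesEquiv C) (he f x)).trans ?_
        exact (isConv_convChart E).groupLikesEquiv_map f (e B x)⟩⟩

end ConvFunctor

end SpecDual

/-! ### Linear maps over the base ring and group-like elements -/

section BoxMul

variable {C : Type*} [CommRing C] [Algebra k C] {E F G N E' F' : Type*}
  [AddCommGroup E] [Module k E] [AddCommGroup F] [Module k F] [AddCommGroup G] [Module k G]
  [AddCommGroup N] [Module k N]
  [AddCommGroup E'] [Module k E'] [AddCommGroup F'] [Module k F']

lemma lTensor_map_boxMul (φ : E →ₗ[k] E') (ψ : F →ₗ[k] F') (p : C ⊗[k] E) (q : C ⊗[k] F) :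
    (TensorProduct.map φ ψ).lTensor C (boxMul p q) = boxMul (φ.lTensor C p) (ψ.lTensor C q) := by
  induction p with
  | zero => simp
  | add x y hx hy => simp only [map_add, LinearMap.add_apply, hx, hy]
  | tmul c e =>
    induction q with
    | zero => simp
    | add x y hx hy => simp only [map_add, hx, hy]
    | tmul d e' => simp

lemma lTensor_comm_boxMul (p : C ⊗[k] E) (q : C ⊗[k] F) :
    (TensorProduct.comm k E F).toLinearMap.lTensor C (boxMul p q) = boxMul q p := by
  induction p with
  | zero => simp
  | add x y hx hy => simp only [map_add, LinearMap.add_apply, hx, hy]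
  | tmul c e =>
    induction q with
    | zero => simp
    | add x y hx hy => simp only [map_add, LinearMap.add_apply, hx, hy]
    | tmul d e' => simp [mul_comm]

lemma lTensor_assoc_symm_boxMul (p : C ⊗[k] E) (q : C ⊗[k] F) (r : C ⊗[k] G) :
    (TensorProduct.assoc k E F G).symm.toLinearMap.lTensor C (boxMul p (boxMul q r)) =
      boxMul (boxMul p q) r := by
  induction p with
  | zero => simp
  | add x y hx hy => simp only [map_add, LinearMap.add_apply, hx, hy]
  | tmul c e =>
    induction q with
    | zero => simp
    | add x y hx hy => simp only [map_add, LinearMap.add_apply, hx, hy]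
    | tmul d e' =>
      induction r with
      | zero => simp
      | add x y hx hy => simp only [map_add, hx, hy]
      | tmul d' e'' => simp [mul_assoc]

lemma lTensor_tensorTensorTensorComm_boxMul (p : C ⊗[k] E) (q : C ⊗[k] F) (p' : C ⊗[k] E')
    (q' : C ⊗[k] F') :
    (TensorProduct.tensorTensorTensorComm k E F E' F').toLinearMap.lTensor C
      (boxMul (boxMul p q) (boxMul p' q')) = boxMul (boxMul p p') (boxMul q q') := by
  induction p with
  | zero => simp
  | add x y hx hy => simp only [map_add, LinearMap.add_apply, hx, hy]
  | tmul c e =>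
    induction q with
    | zero => simp
    | add x y hx hy => simp only [map_add, LinearMap.add_apply, hx, hy]
    | tmul d e' =>
      induction p' with
      | zero => simp
      | add x y hx hy => simp only [map_add, LinearMap.add_apply, hx, hy]
      | tmul d' e'' =>
        induction q' with
        | zero => simp
        | add x y hx hy => simp only [map_add, hx, hy]
        | tmul c' f => simp [mul_mul_mul_comm]

lemma lTensor_mk_apply (e : E) (q : C ⊗[k] F) :
    (TensorProduct.mk k E F e).lTensor C q = boxMul ((1 : C) ⊗ₜ[k] e) q := by
  induction q with
  | zero => simp
  | add x y hx hy => simp only [map_add, hx, hy]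
  | tmul d e' => simp

lemma liftBaseChange_mk_comp (w : E →ₗ[k] N) (p : C ⊗[k] E) :
    (TensorProduct.mk k C N 1 ∘ₗ w).liftBaseChange C p = w.lTensor C p := by
  induction p with
  | zero => simp
  | add x y hx hy => simp only [map_add, hx, hy]
  | tmul d e' => simp [TensorProduct.smul_tmul']

lemma extend_comp_eq_mk_comp (f : k →ₐ[k] C) (w : E →ₗ[k] k ⊗[k] N) :
    extend N f ∘ₗ w =
      TensorProduct.mk k C N 1 ∘ₗ (TensorProduct.lid k N).toLinearMap ∘ₗ w := by
  refine LinearMap.ext fun x => ?_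
  simp only [LinearMap.comp_apply]
  generalize w x = z
  induction z with
  | zero => simp
  | add x y hx hy => simp only [map_add, hx, hy]
  | tmul a n =>
    have h : f a = algebraMap k C a := f.commutes a
    simp [h, Algebra.algebraMap_eq_smul_one, TensorProduct.smul_tmul]

lemma scalarForm_comp_lTensor (ν : N →ₗ[k] k) (w : E →ₗ[k] N) (p : C ⊗[k] E) :
    (scalarForm C (ν ∘ₗ w)).liftBaseChange C p =
      (scalarForm C ν).liftBaseChange C (w.lTensor C p) :=
  (liftBaseChange_lTensor (scalarForm C ν) w p).symm

end BoxMul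

/-! ### Density for one, two and three group-like elements -/

section GroupLikes

open Coalgebra

variable {E F G N : Type u} [AddCommGroup E] [Module k E] [Coalgebra k E] [IsCocomm k E]
  [Module.Projective k E] [AddCommGroup F] [Module k F] [Coalgebra k F] [IsCocomm k F]
  [Module.Projective k F] [AddCommGroup G] [Module k G] [Coalgebra k G] [IsCocomm k G]
  [Module.Projective k G] [AddCommGroup N] [Module k N]

/-- Natural maps from group-like elements to a quasi-coherent functor come from linear maps. -/
lemma exists_lTensor_of_natural
    (Φ : ∀ {C : CommAlgCat.{u} k}, GroupLikes (k := k) C E → C ⊗[k] N)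
    (hΦ : ∀ {C D : CommAlgCat.{u} k} (g : C ⟶ D) (p : GroupLikes (k := k) C E),
      Φ (p.map g.hom) = extend N g.hom (Φ p)) :
    ∃ w : E →ₗ[k] N, ∀ {C : CommAlgCat.{u} k} (p : GroupLikes (k := k) C E),
      Φ p = w.lTensor C p.1 := by
  obtain ⟨w, hw⟩ := exists_linearMap_of_natural (B := .of k k) (fun {C} _ p => Φ (C := C) p)
    fun _ g p => hΦ g p
  refine ⟨(TensorProduct.lid k N).toLinearMap ∘ₗ w, fun {C} p => ?_⟩
  rw [hw (CommAlgCat.ofHom (Algebra.ofId k C)) p, ← liftBaseChange_mk_comp,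
    ← extend_comp_eq_mk_comp (Algebra.ofId k C)]
  rfl

lemma linearMap_ext_lTensor [Module.Projective k N] {v w : E →ₗ[k] N}
    (h : ∀ {C : CommAlgCat.{u} k} (p : GroupLikes (k := k) C E),
      v.lTensor C p.1 = w.lTensor C p.1) : v = w := by
  refine LinearMap.ext fun x => eq_of_forall_functional (k := k) fun ν => ?_
  refine congrArg (fun φ => φ x) (linearMap_ext_groupLikes (B := .of k k) (v := ν ∘ₗ v)
    (w := ν ∘ₗ w) fun {C} f p => ?_)
  -- The algebra `k` is initial, so `f` is the structural morphism.
  obtain rfl : f = CommAlgCat.ofHom (Algebra.ofId k C) := by ext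
  refine (scalarForm_comp_lTensor ν v p.1).trans (Eq.trans ?_ (scalarForm_comp_lTensor ν w p.1).symm)
  rw [h]

lemma linearMap_ext_lTensor_boxMul [Module.Projective k N] {v w : E ⊗[k] F →ₗ[k] N}
    (h : ∀ {C : CommAlgCat.{u} k} (p : GroupLikes (k := k) C E) (q : GroupLikes (k := k) C F),
      v.lTensor C (boxMul p.1 q.1) = w.lTensor C (boxMul p.1 q.1)) : v = w := by
  refine LinearMap.ext fun x => eq_of_forall_functional (k := k) fun ν => ?_
  refine congrArg (fun φ => φ x) (linearMap_ext_boxMul (B := .of k k) (v := ν ∘ₗ v)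
    (w := ν ∘ₗ w) fun {C} f p q => ?_)
  obtain rfl : f = CommAlgCat.ofHom (Algebra.ofId k C) := by ext
  refine (scalarForm_comp_lTensor ν v _).trans (Eq.trans ?_ (scalarForm_comp_lTensor ν w _).symm)
  rw [h]

lemma linearMap_ext_lTensor_boxMul_boxMul [Module.Projective k N]
    {v w : E ⊗[k] (F ⊗[k] G) →ₗ[k] N}
    (h : ∀ {C : CommAlgCat.{u} k} (p : GroupLikes (k := k) C E) (q : GroupLikes (k := k) C F)
      (r : GroupLikes (k := k) C G),
      v.lTensor C (boxMul p.1 (boxMul q.1 r.1)) = w.lTensor C (boxMul p.1 (boxMul q.1 r.1))) :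
    v = w := by
  refine TensorProduct.ext' fun x y => eq_of_forall_functional (k := k) fun ν => ?_
  have h1 : (ν ∘ₗ v) ∘ₗ TensorProduct.mk k E _ x = (ν ∘ₗ w) ∘ₗ TensorProduct.mk k E _ x := by
    refine linearMap_ext_boxMul (B := .of k k) fun {C} f q r => ?_
    have h2 : partialEval (f.hom.toLinearMap ∘ₗ ν ∘ₗ v) (boxMul q.1 r.1) =
        partialEval (f.hom.toLinearMap ∘ₗ ν ∘ₗ w) (boxMul q.1 r.1) := by
      refine linearMap_ext_groupLikes fun {D} g p => ?_
      rw [comp_partialEval, comp_partialEval, ← liftBaseChange_boxMul_eq,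
        ← liftBaseChange_boxMul_eq, extend_boxMul]
      obtain rfl : f = CommAlgCat.ofHom (Algebra.ofId k C) := by ext
      rw [← LinearMap.comp_assoc, ← LinearMap.comp_assoc (ν ∘ₗ w)]
      have hg : g.hom.toLinearMap ∘ₗ (CommAlgCat.ofHom (Algebra.ofId k C)).hom.toLinearMap =
          Algebra.linearMap k D := by ext; simp
      rw [hg]
      refine (scalarForm_comp_lTensor ν v _).trans
        (Eq.trans ?_ (scalarForm_comp_lTensor ν w _).symm)
      exact congrArg _ (h p (q.map g.hom) (r.map g.hom))
    exact congrArg (fun φ => φ x) h2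
  exact congrArg (fun φ => φ y) h1

/-- Natural maps from pairs of group-like elements to a quasi-coherent functor come from linear
maps. -/
lemma exists_lTensor_boxMul_of_natural [Module.Projective k N]
    (Φ : ∀ {C : CommAlgCat.{u} k}, GroupLikes (k := k) C E → GroupLikes (k := k) C F → C ⊗[k] N)
    (hΦ : ∀ {C D : CommAlgCat.{u} k} (g : C ⟶ D) (p : GroupLikes (k := k) C E)
      (q : GroupLikes (k := k) C F),
      Φ (p.map g.hom) (q.map g.hom) = extend N g.hom (Φ p q)) :
    ∃ m : E ⊗[k] F →ₗ[k] N, ∀ {C : CommAlgCat.{u} k} (p : GroupLikes (k := k) C E)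
      (q : GroupLikes (k := k) C F), Φ p q = m.lTensor C (boxMul p.1 q.1) := by
  have hmap : ∀ {C D D' : CommAlgCat.{u} k} (f : C ⟶ D) (g : D ⟶ D')
      (q : GroupLikes (k := k) C F), q.map (f ≫ g).hom = (q.map f.hom).map g.hom :=
    -- The two variables are linearised in turn. For fixed `q`, `Φ` is given by a linear map `W q`
    -- on `E`; by density `W` is natural in `q`, so for fixed `x` the function `q ↦ W q x` comes
    -- from a linear map `v x` on `F`.
    fun f g q => Subtype.ext (extend_comp f.hom g.hom q.1)
  have h1 : ∀ {C : CommAlgCat.{u} k} (q : GroupLikes (k := k) C F),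
      ∃ w : E →ₗ[k] C ⊗[k] N, ∀ {D : CommAlgCat.{u} k} (f : C ⟶ D) (p : GroupLikes (k := k) D E),
        Φ p (q.map f.hom) = (extend N f.hom ∘ₗ w).liftBaseChange D p.1 := fun {C} q =>
    exists_linearMap_of_natural (fun {D} f p => Φ p (q.map f.hom)) fun f g p => by
      rw [hmap, hΦ]
  choose W hW using @h1
  have hnat : ∀ {C D : CommAlgCat.{u} k} (g : C ⟶ D) (q : GroupLikes (k := k) C F),
      W (q.map g.hom) = extend N g.hom ∘ₗ W q := by
    intro C D g q
    refine linearMap_ext_groupLikes' fun {D'} f p => ?_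
    rw [← hW, ← hmap, hW, ← LinearMap.comp_assoc]
    congr 2
    exact LinearMap.ext fun z => extend_comp g.hom f.hom (W q z)
  choose v hv using fun x : E => exists_lTensor_of_natural (k := k) (fun {C} q => W q x)
    fun g q => congrArg (fun φ => φ x) (hnat g q)
  -- Linearity of `v` in `x` is once more density in `q`.
  let V : E →ₗ[k] F →ₗ[k] N :=
    { toFun := v
      map_add' := fun x y => linearMap_ext_lTensor fun {C} q => by
        rw [LinearMap.lTensor_add, LinearMap.add_apply, ← hv, ← hv, ← hv, map_add]
      map_smul' := fun a x => linearMap_ext_lTensor fun {C} q => by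
        rw [RingHom.id_apply, LinearMap.lTensor_smul, LinearMap.smul_apply, ← hv, ← hv, map_smul] }
  refine ⟨TensorProduct.lift V, fun {C} p q => ?_⟩
  have h2 := hW q (𝟙 C) p
  have h3 : q.map (𝟙 C : C ⟶ C).hom = q := Subtype.ext (extend_id q.1)
  have h4 : extend N (𝟙 C : C ⟶ C).hom ∘ₗ W q = W q := LinearMap.ext fun x => extend_id _
  rw [h3, h4] at h2
  rw [h2, ← liftBaseChange_mk_comp, liftBaseChange_boxMul_eq]
  congr 2
  refine LinearMap.ext fun x => ?_
  rw [partialEval_apply, hv, ← liftBaseChange_mk_comp]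
  rfl

end GroupLikes

/-! ### The bialgebra of a monoid of group-like elements -/

section GroupLikeChart

open Coalgebra

/-- An identification of the functor of sets underlying `H` with the functor of group-like elements
of a coalgebra `E`. -/
structure GroupLikeChart (H : MonoidFunctor k) (E : Type u) [AddCommGroup E] [Module k E]
    [Coalgebra k E] where
  equiv : ∀ C : CommAlgCat.{u} k, H.obj C ≃ GroupLikes (k := k) C E
  naturality : ∀ {C D : CommAlgCat.{u} k} (f : C ⟶ D) (x : H.obj C),
    equiv D ((H.map f).hom x) = (equiv C x).map f.hom

lemma map_mul'_tensorTensorTensorComm {A : Type*} [CommRing A] [Algebra k A] (x y : A ⊗[k] A) :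
    TensorProduct.map (LinearMap.mul' k A) (LinearMap.mul' k A)
      (TensorProduct.tensorTensorTensorComm k A A A A (x ⊗ₜ y)) = x * y := by
  induction x with
  | zero => simp
  | add x y hx hy => simp only [TensorProduct.add_tmul, map_add, hx, hy, add_mul]
  | tmul x x' =>
    induction y with
    | zero => simp
    | add x y hx hy => simp only [TensorProduct.tmul_add, map_add, hx, hy, mul_add]
    | tmul y y' => simp

namespace GroupLikeChart

variable {H : MonoidFunctor k} {E : Type u} [AddCommGroup E] [Module k E] [Coalgebra k E]
  (γ : GroupLikeChart H E)

/-- The product of two group-like elements. -/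
def mul {C : CommAlgCat.{u} k} (p q : GroupLikes (k := k) C E) : GroupLikes (k := k) C E :=
  γ.equiv C ((γ.equiv C).symm p * (γ.equiv C).symm q)

lemma mul_assoc' {C : CommAlgCat.{u} k} (p q r : GroupLikes (k := k) C E) :
    γ.mul (γ.mul p q) r = γ.mul p (γ.mul q r) := by
  simp only [mul, Equiv.symm_apply_apply, mul_assoc]

lemma mul_comm' {C : CommAlgCat.{u} k} (p q : GroupLikes (k := k) C E) :
    γ.mul p q = γ.mul q p := by
  simp only [mul, mul_comm]

lemma one_mul' {C : CommAlgCat.{u} k} (p : GroupLikes (k := k) C E) :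
    γ.mul (γ.equiv C 1) p = p := by
  simp only [mul, Equiv.symm_apply_apply, one_mul, Equiv.apply_symm_apply]

lemma mul_map {C D : CommAlgCat.{u} k} (f : C ⟶ D) (p q : GroupLikes (k := k) C E) :
    γ.mul (p.map f.hom) (q.map f.hom) = (γ.mul p q).map f.hom := by
  have h : ∀ p : GroupLikes (k := k) C E,
      (γ.equiv D).symm (p.map f.hom) = (H.map f).hom ((γ.equiv C).symm p) := fun p => by
    rw [Equiv.symm_apply_eq, γ.naturality, Equiv.apply_symm_apply]
  rw [mul, mul, h, h, ← map_mul, γ.naturality]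

/-- The element of `E` defining the unit. -/
def unit : E := TensorProduct.lid k E (γ.equiv (.of k k) 1).1

/-- By naturality the unit over `C` is the image of the unit over the initial algebra `k`. -/
lemma equiv_one (C : CommAlgCat.{u} k) : (γ.equiv C 1).1 = (1 : C) ⊗ₜ[k] γ.unit := by
  have h := γ.naturality (CommAlgCat.ofHom (Algebra.ofId k C)) 1
  rw [map_one] at h
  refine (congrArg Subtype.val h).trans ?_
  change extend E (Algebra.ofId k C) (γ.equiv (.of k k) 1).1 = _
  have h2 := congrArg (fun φ => φ (1 : k)) (extend_comp_eq_mk_comp (Algebra.ofId k C)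
    (LinearMap.toSpanSingleton k _ (γ.equiv (.of k k) 1).1))
  simp only [LinearMap.comp_apply, LinearMap.toSpanSingleton_apply, one_smul] at h2
  exact h2

lemma counit_unit : counit (R := k) γ.unit = 1 := by
  have h := (γ.equiv (.of k k) 1).2.counit_eq
  rw [equiv_one] at h
  simpa using h

lemma comul_unit : comul (R := k) γ.unit = γ.unit ⊗ₜ γ.unit := by
  have h := (γ.equiv (.of k k) 1).2.comul_eq
  rw [equiv_one] at h
  have h1 := congrArg (TensorProduct.lid k (E ⊗[k] E)) h
  simpa using h1

variable [IsCocomm k E] [Module.Projective k E]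

lemma exists_mulMap : ∃ m : E ⊗[k] E →ₗ[k] E, ∀ {C : CommAlgCat.{u} k}
    (p q : GroupLikes (k := k) C E), (γ.mul p q).1 = m.lTensor C (boxMul p.1 q.1) :=
  exists_lTensor_boxMul_of_natural (fun p q => (γ.mul p q).1) fun g p q =>
    congrArg Subtype.val (γ.mul_map g p q)

/-- The linear map defining the product. -/
def mulMap : E ⊗[k] E →ₗ[k] E := γ.exists_mulMap.choose

lemma mul_val {C : CommAlgCat.{u} k} (p q : GroupLikes (k := k) C E) :
    (γ.mul p q).1 = γ.mulMap.lTensor C (boxMul p.1 q.1) :=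
  γ.exists_mulMap.choose_spec p q

lemma mulMap_comm (x y : E) : γ.mulMap (x ⊗ₜ y) = γ.mulMap (y ⊗ₜ x) := by
  have h : γ.mulMap = γ.mulMap ∘ₗ (TensorProduct.comm k E E).toLinearMap :=
    linearMap_ext_lTensor_boxMul fun p q => by
      rw [LinearMap.lTensor_comp_apply, lTensor_comm_boxMul, ← mul_val, ← mul_val, mul_comm']
  exact congrArg (fun φ => φ (x ⊗ₜ[k] y)) h

lemma unit_mulMap (x : E) : γ.mulMap (γ.unit ⊗ₜ x) = x := by
  have h : γ.mulMap ∘ₗ TensorProduct.mk k E E γ.unit = LinearMap.id :=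
    linearMap_ext_lTensor fun {C} p => by
      rw [LinearMap.lTensor_comp_apply, lTensor_mk_apply, ← equiv_one, ← mul_val, one_mul',
        LinearMap.lTensor_id_apply]
  exact congrArg (fun φ => φ x) h

/-- On external products of three group-like elements this is associativity of the monoid; density
does the rest. -/
lemma mulMap_assoc (x y z : E) :
    γ.mulMap (γ.mulMap (x ⊗ₜ y) ⊗ₜ z) = γ.mulMap (x ⊗ₜ γ.mulMap (y ⊗ₜ z)) := by
  have h : γ.mulMap ∘ₗ TensorProduct.map γ.mulMap LinearMap.id ∘ₗ
      (TensorProduct.assoc k E E E).symm.toLinearMap =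
        γ.mulMap ∘ₗ TensorProduct.map LinearMap.id γ.mulMap :=
    linearMap_ext_lTensor_boxMul_boxMul fun p q r => by
      rw [LinearMap.lTensor_comp_apply, LinearMap.lTensor_comp_apply, lTensor_assoc_symm_boxMul,
        lTensor_map_boxMul, LinearMap.lTensor_comp_apply, lTensor_map_boxMul, ← mul_val, ← mul_val,
        LinearMap.lTensor_id_apply, LinearMap.lTensor_id_apply, ← mul_val, ← mul_val, mul_assoc']
  exact congrArg (fun φ => φ (x ⊗ₜ[k] (y ⊗ₜ[k] z))) h

lemma counit_mulMap (x y : E) :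
    counit (R := k) (γ.mulMap (x ⊗ₜ y)) = counit (R := k) x * counit (R := k) y := by
  have h : counit (R := k) (A := E) ∘ₗ γ.mulMap =
      LinearMap.mul' k k ∘ₗ TensorProduct.map counit counit := by
    refine linearMap_ext_boxMul (B := .of k k) fun {C} f p q => ?_
    obtain rfl : f = CommAlgCat.ofHom (Algebra.ofId k C) := by ext
    refine (scalarForm_comp_lTensor counit γ.mulMap _).trans ?_
    rw [← mul_val, (γ.mul p q).2.counit_eq]
    have h2 : (CommAlgCat.ofHom (Algebra.ofId k C)).hom.toLinearMap ∘ₗ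
        LinearMap.mul' k k ∘ₗ TensorProduct.map counit counit =
        LinearMap.mul' k C ∘ₗ TensorProduct.map (scalarForm C (counit (R := k) (A := E)))
          (scalarForm C (counit (R := k) (A := E))) := by
      ext; simp
    refine Eq.trans ?_ (congrArg (fun φ => LinearMap.liftBaseChange C φ (boxMul p.1 q.1)) h2).symm
    rw [liftBaseChange_boxMul, p.2.counit_eq, q.2.counit_eq, mul_one]
  exact congrArg (fun φ => φ (x ⊗ₜ[k] y)) h

/-- Tested on pairs of group-like elements, the compatibility says that their product is again
group-like. -/
lemma comul_mulMap (x y : E) : comul (R := k) (γ.mulMap (x ⊗ₜ y)) =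
    TensorProduct.map γ.mulMap γ.mulMap (TensorProduct.tensorTensorTensorComm k E E E E
      (comul (R := k) x ⊗ₜ comul (R := k) y)) := by
  have h : comul (R := k) (A := E) ∘ₗ γ.mulMap = TensorProduct.map γ.mulMap γ.mulMap ∘ₗ
      (TensorProduct.tensorTensorTensorComm k E E E E).toLinearMap ∘ₗ
        TensorProduct.map comul comul :=
    linearMap_ext_lTensor_boxMul fun {C} p q => by
      rw [LinearMap.lTensor_comp_apply, LinearMap.lTensor_comp_apply, LinearMap.lTensor_comp_apply,
        lTensor_map_boxMul, p.2.comul_eq, q.2.comul_eq, lTensor_tensorTensorTensorComm_boxMul,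
        lTensor_map_boxMul, ← mul_val, (γ.mul p q).2.comul_eq]
  exact congrArg (fun φ => φ (x ⊗ₜ[k] y)) h

lemma mulMap_add_left (x y z : E) :
    γ.mulMap ((x + y) ⊗ₜ z) = γ.mulMap (x ⊗ₜ z) + γ.mulMap (y ⊗ₜ z) := by
  rw [TensorProduct.add_tmul, map_add]

lemma mulMap_add_right (x y z : E) :
    γ.mulMap (x ⊗ₜ (y + z)) = γ.mulMap (x ⊗ₜ y) + γ.mulMap (x ⊗ₜ z) := by
  rw [TensorProduct.tmul_add, map_add]

lemma mulMap_smul_left (a : k) (x y : E) :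
    γ.mulMap ((a • x) ⊗ₜ y) = a • γ.mulMap (x ⊗ₜ y) := by
  rw [← TensorProduct.smul_tmul', map_smul]

lemma mulMap_smul_right (a : k) (x y : E) :
    γ.mulMap (x ⊗ₜ (a • y)) = a • γ.mulMap (x ⊗ₜ y) := by
  rw [TensorProduct.tmul_smul, map_smul]

/-- The ring structure defined by a chart. -/
abbrev commRing : CommRing E :=
  { ‹AddCommGroup E› with
    mul := fun x y => γ.mulMap (x ⊗ₜ[k] y)
    one := γ.unit
    mul_comm := γ.mulMap_comm
    mul_assoc := γ.mulMap_assoc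
    one_mul := γ.unit_mulMap
    mul_one := fun x => (γ.mulMap_comm x γ.unit).trans (γ.unit_mulMap x)
    zero_mul := fun x => by
      change γ.mulMap ((0 : E) ⊗ₜ x) = 0
      rw [TensorProduct.zero_tmul, map_zero]
    mul_zero := fun x => by
      change γ.mulMap (x ⊗ₜ (0 : E)) = 0
      rw [TensorProduct.tmul_zero, map_zero]
    left_distrib := γ.mulMap_add_right
    right_distrib := γ.mulMap_add_left }

/-- The algebra structure defined by a chart. -/
abbrev algebra : letI := γ.commRing; Algebra k E :=
  letI := γ.commRing
  Algebra.ofModule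
    γ.mulMap_smul_left γ.mulMap_smul_right

lemma mul'_eq : letI := γ.commRing; letI := γ.algebra; LinearMap.mul' k E = γ.mulMap :=
  TensorProduct.ext' fun _ _ => rfl

/-- The bialgebra structure defined by a chart. -/
abbrev bialgebra : letI := γ.commRing; Bialgebra k E :=
  letI := γ.commRing
  letI := γ.algebra
  letI : Coalgebra k E := ‹Coalgebra k E›
  Bialgebra.mk' k E γ.counit_unit (fun {a b} => γ.counit_mulMap a b) γ.comul_unit
    (fun {a b} => by
      refine (γ.comul_mulMap a b).trans ?_
      rw [← γ.mul'_eq]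
      exact map_mul'_tensorTensorTensorComm (comul (R := k) a) (comul (R := k) b))

/-- A functor of monoids identified with group-like elements is the one of a bialgebra. -/
lemma exists_bialgebra (γ : GroupLikeChart H E) :
    ∃ (A : Type u) (_ : CommRing A) (_ : Bialgebra k A) (_ : IsCocomm k A)
    (_ : Module.Projective k A), Nonempty (A ≃ₗ[k] E) ∧ Nonempty (H ≅ groupLikeMonoid k A) := by
  let _ := γ.commRing
  let _ := γ.bialgebra
  refine ⟨E, γ.commRing, γ.bialgebra, ‹IsCocomm k E›, ‹Module.Projective k E›,
    ⟨LinearEquiv.refl k E⟩, ?_⟩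
  let τ : H ⟶ groupLikeMonoid k E :=
    { app := fun C => CommMonCat.ofHom
        { toFun := fun x => ⟨γ.equiv C x⟩
          map_one' := ULift.ext _ _ (Subtype.ext (γ.equiv_one C))
          map_mul' := fun x y => ULift.ext _ _ (Subtype.ext (by
            refine Eq.trans ?_ (lTensor_mul'_boxMul (γ.equiv C x).1 (γ.equiv C y).1)
            refine Eq.trans ?_ ((γ.mul_val (γ.equiv C x) (γ.equiv C y)).trans
              (congrArg (fun m => LinearMap.lTensor C m _) γ.mul'_eq.symm))
            exact congrArg (fun t => (γ.equiv C t).1) (congrArg₂ (· * ·)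
              ((γ.equiv C).symm_apply_apply x).symm ((γ.equiv C).symm_apply_apply y).symm))) }
      naturality := fun C D f => CommMonCat.hom_ext <| MonoidHom.ext fun x =>
        ULift.ext _ _ (γ.naturality f x) }
  have : IsIso τ := isIso_of_bijective _ fun C =>
    ⟨fun x y h => (γ.equiv C).injective (congrArg (fun t => ULift.down t) h),
      fun a => ⟨(γ.equiv C).symm (ULift.down a),
        ULift.ext _ _ ((γ.equiv C).apply_symm_apply _)⟩⟩
  exact ⟨asIso τ⟩

end GroupLikeChart

end GroupLikeChart

/-! ### Duality between affine monoids and monoids of group-like elements -/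

section Duality

open Coalgebra

lemma IsSpec.of_iso {G G' : MonoidFunctor k} {A : CommAlgCat.{u} k} (e : G ≅ G')
    (h : IsSpec G' A) : IsSpec G A :=
  h.map fun i => Functor.isoWhiskerRight e (forget CommMonCat) ≪≫ i

lemma IsSpecDual.of_iso {H H' : MonoidFunctor k} {E : Type u} [AddCommGroup E] [Module k E]
    (e : H ≅ H') (h : IsSpecDual H' E) : IsSpecDual H E := by
  obtain ⟨𝒜, h1, h2⟩ := h
  exact ⟨𝒜, h1, h2.map fun i => Functor.isoWhiskerRight e (forget CommMonCat) ≪≫ i⟩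

/-- A functor of monoids on the spectrum of the dual of a coalgebra is identified with group-like
elements. -/
def DualChart.IsConv.groupLikeChart {H : MonoidFunctor k} {𝒜 : AlgebraFunctor.{u + 1} k}
    {E : Type u} [AddCommGroup E] [Module k E] [Coalgebra k E] [Module.Projective k E]
    {θ : DualChart 𝒜 E} (hθ : θ.IsConv) (e : H ⋙ forget CommMonCat ≅ spec 𝒜) :
    GroupLikeChart H E where
  equiv C := (e.app C).toEquiv.trans (hθ.groupLikesEquiv C).symm
  naturality {C D} f x := by
    refine ((hθ.groupLikesEquiv D).symm_apply_eq).mpr ?_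
    refine Eq.trans ?_ (hθ.groupLikesEquiv_map f _).symm
    refine (congrArg (fun t => t x) (e.hom.naturality f)).trans ?_
    exact congrArg ((spec 𝒜).map f) ((hθ.groupLikesEquiv C).apply_symm_apply _).symm

lemma IsSpecDual.exists_groupLikeChart {H : MonoidFunctor k} {E : Type u} [AddCommGroup E]
    [Module k E] [Module.Projective k E] (h : IsSpecDual H E) :
    ∃ (_ : Coalgebra k E) (_ : IsCocomm k E), Nonempty (GroupLikeChart H E) := by
  obtain ⟨𝒜, ⟨i⟩, ⟨e⟩⟩ := h
  let _ := (DualChart.ofIso i).coalgebra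
  exact ⟨(DualChart.ofIso i).coalgebra, (DualChart.ofIso i).isCocomm,
    ⟨(DualChart.ofIso i).isConv.groupLikeChart e⟩⟩

section Bialgebra

variable (A : Type u) [CommRing A] [Bialgebra k A] [IsCocomm k A]

variable (k) in
lemma isSpec_pointsMonoid : IsSpec (pointsMonoid k A) (.of k A) :=
  ⟨NatIso.ofComponents (fun C => (Equiv.toIso
    { toFun := fun a : ULift.{u + 1} (WithConv (A →ₐ[k] C)) => ⟨CommAlgCat.ofHom a.down.ofConv⟩
      invFun := fun f => ⟨WithConv.toConv (ULift.down f).hom⟩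
      left_inv := fun _ => rfl
      right_inv := fun _ => rfl })) fun _ => rfl⟩

/-- The dual of the monoid of group-like elements is the monoid of points. -/
def dualGroupLikeIso [Module.Projective k A] : dual (groupLikeMonoid k A) ≅ pointsMonoid k A :=
  (asIso (evalPairing k A)).symm

/-- The dual of the monoid of points is the monoid of group-like elements. -/
def dualPointsIso : dual (pointsMonoid k A) ≅ groupLikeMonoid k A :=
  (asIso (transpose (evalPairing k A))).symm

variable (k) in
lemma isSpecDual_groupLikeMonoid [Module.Projective k A] : IsSpecDual (groupLikeMonoid k A) A :=
  isSpecDual_of_equiv A (H := groupLikeMonoid k A) (fun _ => Equiv.ulift) fun _ _ => rfl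

/-! ### The finite case: group-like elements form an affine scheme -/

section Finite

/-- A morphism of algebras from the dual of a finite projective coalgebra is the evaluation at a
group-like element. -/
lemma exists_isGroupLike_of_algHom [Module.Finite k A] [Module.Projective k A]
    {B : Type u} [CommRing B] [Algebra k B] (φ : ConvAlg k k A →ₐ[k] B) :
    ∃ p : GroupLikes (k := k) B A, p.2.toAlgHom (Algebra.ofId k B) = φ := by
  obtain ⟨Y, hY⟩ := Module.finite_def.mp ‹Module.Finite k A›
  obtain ⟨T, e, he⟩ := exists_dualBasis (k := k) Y
  -- A dual basis for generators is a full dual basis, so the universal element of the truncations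
  -- is now a finite sum and no truncation is needed.
  have hid : (LinearMap.id : A →ₗ[k] A) = ∑ l ∈ T, (e l).smulRight l :=
    LinearMap.ext_on hY fun y hy => by
      rw [LinearMap.sum_apply]
      exact he y hy
  let g : B ⊗[k] A := ∑ l ∈ T, φ (ConvAlg.of k k A (e l)) ⊗ₜ[k] l
  have hg : ∀ w : A →ₗ[k] k,
      (scalarForm B w).liftBaseChange B g = φ (ConvAlg.of k k A w) := by
    intro w
    -- The forms `e l` span `Hom(A, k)`, so agreement of the pairing with `φ` follows by linearity.
    have hw : w = ∑ l ∈ T, w l • e l := by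
      conv_lhs => rw [← LinearMap.comp_id w, hid]
      ext x
      simp [mul_comm]
    conv_rhs => rw [hw, map_sum, map_sum]
    rw [map_sum]
    refine Finset.sum_congr rfl fun l _ => ?_
    rw [map_smul, map_smul, LinearMap.liftBaseChange_tmul, Algebra.smul_def (w l), mul_comm]
    rfl
  have hg' : IsGroupLike g :=
    isGroupLike_of_scalarForm ((hg _).trans (map_one φ)) fun v w => by
      rw [hg, hg, hg, ← map_mul]
      rfl
  exact ⟨⟨g, hg'⟩, AlgHom.ext fun w => hg w.lin⟩

lemma toAlgHom_injective [Module.Projective k A] {B : Type u} [CommRing B] [Algebra k B] :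
    Function.Injective fun p : GroupLikes (k := k) B A => p.2.toAlgHom (Algebra.ofId k B) := by
  intro p q h
  refine Subtype.ext (eq_of_scalarForm fun w => ?_)
  exact congrArg (fun φ => φ (ConvAlg.of k k A w)) h

variable (k) in
lemma isSpec_groupLikeMonoid [Module.Finite k A] [Module.Projective k A] :
    IsSpec (groupLikeMonoid k A) (.of k (ConvAlg k k A)) := by
  let e (C : CommAlgCat.{u} k) : GroupLikes (k := k) C A ≃ (ConvAlg k k A →ₐ[k] C) :=
    Equiv.ofBijective _ ⟨toAlgHom_injective A, exists_isGroupLike_of_algHom A⟩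
  have he : ∀ {C D : CommAlgCat.{u} k} (f : C ⟶ D) (p : GroupLikes (k := k) C A),
      e D (p.map f.hom) = f.hom.comp (e C p) := fun {C D} f p => AlgHom.ext fun w => by
    refine Eq.trans ?_ (liftBaseChange_extend f.hom (scalarForm C w.lin) p.1)
    rw [scalarForm_comp]
    rfl
  refine ⟨NatIso.ofComponents (fun C => (Equiv.toIso
    { toFun := fun p : ULift.{u + 1} (groupLikeSubmonoid k C A) => ⟨CommAlgCat.ofHom (e C p.down)⟩
      invFun := fun f => ⟨(e C).symm (ULift.down f).hom⟩
      left_inv := fun p => ULift.ext _ _ ((e C).symm_apply_apply p.down)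
      right_inv := fun f => ULift.ext _ _ (CommAlgCat.hom_ext
        ((e C).apply_symm_apply (ULift.down f).hom)) })) fun {C D} f => ?_⟩
  ext p
  exact ULift.ext _ _ (CommAlgCat.hom_ext (he f (ULift.down p)))

instance [Module.Finite k A] [Module.Projective k A] : Module.Finite k (ConvAlg k k A) :=
  Module.Finite.equiv (ConvAlg.of k k A)

instance [Module.Finite k A] [Module.Projective k A] : Module.Projective k (ConvAlg k k A) :=
  Module.Projective.of_equiv (ConvAlg.of k k A)

end Finite

end Bialgebra

/-! ### Transport to the objects of the two categories -/

section Spec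

variable {G : MonoidFunctor k} {A : CommAlgCat.{u} k} [Module.Projective k A]

theorem IsSpec.isSpecDual_dual (h : IsSpec G A) : IsSpecDual (dual G) A := by
  obtain ⟨ε⟩ := h.nonempty_affineChart
  let _ := ε.bialgebra
  have := ε.isCocomm
  obtain ⟨i⟩ := ε.nonempty_iso
  exact (isSpecDual_groupLikeMonoid k A).of_iso (dualIso i ≪≫ dualPointsIso A)

theorem IsSpec.isIso_biduality (h : IsSpec G A) : IsIso (biduality G) := by
  obtain ⟨ε⟩ := h.nonempty_affineChart
  let _ := ε.bialgebra
  have := ε.isCocomm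
  obtain ⟨i⟩ := ε.nonempty_iso
  have := isIso_biduality_left (evalPairing k A)
  exact isIso_biduality_of_iso i

theorem IsSpec.exists_isSpec_dual [Module.Finite k A] (h : IsSpec G A) :
    ∃ A' : CommAlgCat.{u} k, Module.Finite k A' ∧ Module.Projective k A' ∧
      IsSpec (dual G) A' := by
  obtain ⟨ε⟩ := h.nonempty_affineChart
  let _ := ε.bialgebra
  have := ε.isCocomm
  obtain ⟨i⟩ := ε.nonempty_iso
  exact ⟨.of k (ConvAlg k k A), inferInstanceAs (Module.Finite k (ConvAlg k k A)),
    inferInstanceAs (Module.Projective k (ConvAlg k k A)),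
    (isSpec_groupLikeMonoid k A).of_iso (dualIso i ≪≫ dualPointsIso A)⟩

end Spec

section SpecDual

variable {H : MonoidFunctor k} {E : Type u} [AddCommGroup E] [Module k E] [Module.Projective k E]

/-- The algebra structure on `𝐄*` supplies the coalgebra structure, and the monoid law supplies the
multiplication. -/
lemma IsSpecDual.exists_bialgebra (h : IsSpecDual H E) :
    ∃ (A : Type u) (_ : CommRing A) (_ : Bialgebra k A) (_ : IsCocomm k A)
      (_ : Module.Projective k A), Nonempty (A ≃ₗ[k] E) ∧ Nonempty (H ≅ groupLikeMonoid k A) := by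
  obtain ⟨_, _, ⟨γ⟩⟩ := h.exists_groupLikeChart
  exact γ.exists_bialgebra

theorem IsSpecDual.exists_isSpec_dual (h : IsSpecDual H E) :
    ∃ A : CommAlgCat.{u} k, Nonempty (A ≃ₗ[k] E) ∧ IsSpec (dual H) A := by
  obtain ⟨A, _, _, _, _, he, ⟨i⟩⟩ := h.exists_bialgebra
  exact ⟨.of k A, he, (isSpec_pointsMonoid k A).of_iso (dualIso i ≪≫ dualGroupLikeIso A)⟩

theorem IsSpecDual.isIso_biduality (h : IsSpecDual H E) : IsIso (biduality H) := by
  obtain ⟨A, _, _, _, _, -, ⟨i⟩⟩ := h.exists_bialgebra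
  have := isIso_biduality_right (evalPairing k A)
  exact isIso_biduality_of_iso i

end SpecDual

/-! ### Characters of functors of groups -/

section Group

variable {G : MonoidFunctor k}

lemma Character.isUnit_apply (hG : ∀ (B : CommAlgCat.{u} k) (x : G.obj B), IsUnit x)
    {B C : CommAlgCat.{u} k} (χ : Character G B) (f : B ⟶ C) (x : G.obj C) :
    IsUnit (χ.app f x) := (hG C x).map (χ.app f)

/-- The inverse of a character of a functor of groups. -/
def Character.inverse (hG : ∀ (B : CommAlgCat.{u} k) (x : G.obj B), IsUnit x)
    {B : CommAlgCat.{u} k} (χ : Character G B) : Character G B where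
  app f :=
    -- `Ring.inverse` is zero away from units, but the values here are units; naturality relies on
    -- this.
    { toFun := fun x => Ring.inverse (χ.app f x)
      map_one' := by rw [map_one, Ring.inverse_one]
      map_mul' := fun x y => by rw [map_mul, mul_comm, Ring.mul_inverse_rev] }
  naturality {C D} f g x := by
    change Ring.inverse (χ.app (f ≫ g) _) = g.hom (Ring.inverse (χ.app f x))
    rw [χ.naturality]
    obtain ⟨u, hu⟩ := χ.isUnit_apply hG f x
    rw [← hu, Ring.inverse_unit]
    exact Ring.inverse_unit (Units.map (g.hom : C →* D) u)

lemma Character.isUnit (hG : ∀ (B : CommAlgCat.{u} k) (x : G.obj B), IsUnit x)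
    {B : CommAlgCat.{u} k} (χ : Character G B) : IsUnit χ :=
  .of_mul_eq_one (χ.inverse hG) <| Character.ext_app fun f => MonoidHom.ext fun x =>
    Ring.mul_inverse_cancel _ (χ.isUnit_apply hG f x)

lemma finiteGroups_dual (hG : finiteGroups k G) : finiteGroups k (dual G) := by
  obtain ⟨⟨A, _, _, hA⟩, hu⟩ := hG
  exact ⟨hA.exists_isSpec_dual, fun B χ => Character.isUnit hu χ⟩

end Group

end Duality

end CartierDuality

end

/-! ### Assembly of the theorem -/

open CartierDuality in
theorem mainTheorem1 (k : Type u) [CommRing k] :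
    DualAntiEquivalence (affineMonoids k) (specDualMonoids k) ∧
    (∀ (G : MonoidFunctor k) (A : CommAlgCat.{u} k), Module.Projective k A →
      IsSpec G A → IsSpecDual (dual G) A) ∧
    (∀ (H : MonoidFunctor k) (E : ModuleCat.{u} k), Module.Projective k E →
      IsSpecDual H E → ∃ A : CommAlgCat.{u} k, Nonempty (A ≃ₗ[k] E) ∧ IsSpec (dual H) A) ∧
    DualAntiEquivalence (finiteGroups k) (finiteGroups k) ∧
    (∀ G : MonoidFunctor k, finiteGroups k G →
      ∀ (B C : CommAlgCat.{u} k) (χ : Character G B) (f : B ⟶ C) (x : G.obj C),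
        IsUnit (χ.app f x)) := by
  refine ⟨.of_isIso_biduality ?_ ?_ ?_ ?_, ?_, ?_, ?_, ?_⟩
  · rintro G ⟨A, _, h⟩
    exact ⟨.of k A, ‹_›, h.isSpecDual_dual⟩
  · rintro H ⟨E, _, h⟩
    obtain ⟨A, ⟨e⟩, hA⟩ := h.exists_isSpec_dual
    exact ⟨A, .of_equiv e.symm, hA⟩
  · rintro G ⟨A, _, h⟩
    exact h.isIso_biduality
  · rintro H ⟨E, _, h⟩
    exact h.isIso_biduality
  · intro G A _ h
    exact h.isSpecDual_dual
  · intro H E _ h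
    exact h.exists_isSpec_dual
  · have h : ∀ G, finiteGroups k G → IsIso (biduality G) := by
      rintro G ⟨⟨A, _, _, h⟩, -⟩
      exact h.isIso_biduality
    exact .of_isIso_biduality (fun _ => finiteGroups_dual) (fun _ => finiteGroups_dual) h h
  · rintro G ⟨-, hu⟩ B C χ f x
    exact χ.isUnit_apply hu f x
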